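/- There are absolute constants $\alpha_1,\alpha_2,\alpha_3>0$ such that the following holds. For each $n$ let $p_n,q_n\in(0,1)$, let $\mathcal S=\mathcal S_n\subset[n]$ be a set of $s=s_n$ seed nodes, and let $\theta^*=\theta^*_n=(\theta_0^*,\theta_1^*,\theta_2^*)\in\mathbb R^3$ satisfy $\theta_0^*+\theta_1^*a+\theta_2^*y\in[0,1]$ for all $a,y\in\{0,1\}$. Let $A\sim\mathrm{ER}(p_n)$ and $Y\sim\mathrm{ER}(q_n)$ be independent random adjacency matrices on $[n]$ (symmetric, zero diagonal, with i.i.d. Bernoulli entries for $i>j$). Let $P_{ij}=\theta_0^*+\theta_1^*A_{ij}+\theta_2^*Y_{ij}$ for $i\ne j$ and $P_{ii}=0$. Let $B$ be a random adjacency matrix whose entries $B_{ij}$, $i>j$, are, conditionally on $(A,Y)$, independent $\mathrm{Ber}(P_{ij})$ variables. Let $Q^*=Q^*_n$ be a permutation matrix with $Q^*_{\mathcal S,\mathcal S}=I_s$, and let $\widetilde B=Q^{*\top}BQ^*$ be the observed second graph. The seeded QAP estimator $\widehat Q$ is computed as follows. With $X_{ij}=(1,A_{ij},Y_{ij})$ for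 $i\neq j$ and $X_{ii}=0$, let $$\widehat\theta\in\operatorname*{argmin}_{\theta\in\mathbb R^3}\sum_{i,j\in\mathcal S,\,i>j}\Bigl\{-\widetilde B_{ij}X_{ij}^\top\theta+\tfrac12(X_{ij}^\top\theta)^2\Bigr\},\qquad \widehat P_{ij}=X_{ij}^\top\widehat\theta,$$ $$\widehat Q\in\operatorname*{argmin}\bigl\{\|\widehat P-Q\widetilde BQ^\top\|_F^2:\ Q\text{ a permutation matrix},\ Q_{\mathcal S,\mathcal S}=I_s\bigr\},$$ where ties are broken in an arbitrary way. Put $\tau_n=\min\{p_n,q_n\}$ and $m_n=\theta_0^*+\theta_1^*p_n+\theta_2^*q_n$. Suppose that $s\to\infty$ as $n\to\infty$ and that 1. $\sqrt{p_n}+\sqrt{q_n}\le 1-\nu$ for some fixed $\nu>0$ and all large $n$; 2. $\max\{p_n,q_n\}=o\bigl(s^2\min\{p_n^2,q_n^2\}\bigr)$; 3. $m_n=O(\min\{p_n,q_n\})$; 4. $m_n\ge\alpha_1\frac{\log n}{n}$ for all large $n$; 5. $\frac{\tau_n^2}{p_n+q_n}\ge\alpha_2\frac{\log n}{n}$ for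 all large $n$; 6. $(\theta_1^*)^2+(\theta_2^*)^2\ge\alpha_3\max\Bigl\{\frac{\log n}{\tau_n n},\ \frac{\sqrt{\log s}\;m_n}{\tau_n^{3/2}s}\Bigr\}$ for all large $n$. Then $\mathbb P(\widehat Q=Q^*)=1-o(1)$ as $n\to\infty$. -/

import Mathlib

open MeasureTheory ProbabilityTheory Filter Topology Asymptotics Matrix

namespace CovMatching

/-- The unordered pairs of distinct vertices, listed as `(i, j)` with `i > j`. -/
abbrev Pairs (n : ℕ) : Type := {e : Fin n × Fin n // e.2 < e.1}

/-- `A ∼ ER(p)`: a random adjacency matrix (symmetric, 0/1 entries, zero diagonal) whose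
entries `A i j`, `i > j`, are independent and equal to `1` with probability `p`. -/
structure IsER {Ω : Type*} [MeasurableSpace Ω] (μ : Measure Ω) {n : ℕ}
    (A : Ω → Matrix (Fin n) (Fin n) ℝ) (p : ℝ) : Prop where
  isAdj : ∀ ω, (A ω).IsAdjMatrix
  measurable : ∀ i j, Measurable fun ω => A ω i j
  indep : iIndepFun (fun (e : Pairs n) (ω : Ω) => A ω e.1.1 e.1.2) μ
  prob : ∀ e : Pairs n, μ {ω | A ω e.1.1 e.1.2 = 1} = ENNReal.ofReal p

/-- The predictor vector `X i j = (1, A i j, Y i j)` for `i ≠ j`, and `X i i = 0`. -/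
noncomputable def predictor {n : ℕ} (A Y : Matrix (Fin n) (Fin n) ℝ) (i j : Fin n) : Fin 3 → ℝ :=
  if i = j then 0 else ![1, A i j, Y i j]

/-- The linear (identity link) model matrix: `θ₀ + θ₁ A i j + θ₂ Y i j` off the diagonal,
`0` on the diagonal. -/
noncomputable def linearMean {n : ℕ} (A Y : Matrix (Fin n) (Fin n) ℝ) (θ : Fin 3 → ℝ) :
    Matrix (Fin n) (Fin n) ℝ :=
  Matrix.of fun i j => predictor A Y i j ⬝ᵥ θ

/-- The random matrix `B` is an adjacency matrix and, conditionally on `(A, Y)`, its entries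
`B i j`, `i > j`, are independent Bernoulli variables with means
`P i j = θ₀ + θ₁ A i j + θ₂ Y i j`. (`A` and `Y` take finitely many values, so the conditional
law is described on the atoms.) -/
structure IsBernoulliResponse {Ω : Type*} [MeasurableSpace Ω] (μ : Measure Ω) {n : ℕ}
    (A Y B : Ω → Matrix (Fin n) (Fin n) ℝ) (θ : Fin 3 → ℝ) : Prop where
  isAdj : ∀ ω, (B ω).IsAdjMatrix
  measurable : ∀ i j, Measurable fun ω => B ω i j
  condLaw : ∀ a y b : Matrix (Fin n) (Fin n) ℝ,
    a.IsAdjMatrix → y.IsAdjMatrix → b.IsAdjMatrix →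
    μ {ω | A ω = a ∧ Y ω = y ∧ B ω = b} =
      μ {ω | A ω = a ∧ Y ω = y} *
        ∏ e : Pairs n, ENNReal.ofReal
          (if b e.1.1 e.1.2 = 1 then linearMean a y θ e.1.1 e.1.2
            else 1 - linearMean a y θ e.1.1 e.1.2)

/-- `Q` is a permutation matrix with `Q_{S,S} = I`. -/
def IsSeededPerm {n : ℕ} (S : Finset (Fin n)) (Q : Matrix (Fin n) (Fin n) ℝ) : Prop :=
  (∃ σ : Equiv.Perm (Fin n), Q = σ.permMatrix ℝ) ∧
    ∀ i ∈ S, ∀ j ∈ S, Q i j = (1 : Matrix (Fin n) (Fin n) ℝ) i j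

/-- The squared Frobenius norm. -/
noncomputable def frobSq {n : ℕ} (M : Matrix (Fin n) (Fin n) ℝ) : ℝ := ∑ i, ∑ j, M i j ^ 2

/-- The generalized linear model loss on the seed pairs, for the linear model
(cumulant function `ψ t = t ^ 2 / 2`, that is, ordinary least squares). -/
noncomputable def seedLoss {n : ℕ} (S : Finset (Fin n)) (A Y Bt : Matrix (Fin n) (Fin n) ℝ)
    (θ : Fin 3 → ℝ) : ℝ :=
  ∑ i ∈ S, ∑ j ∈ S with j < i,
    (-(Bt i j * (predictor A Y i j ⬝ᵥ θ)) + (predictor A Y i j ⬝ᵥ θ) ^ 2 / 2)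

/-- `θhat` is a minimizer over `ℝ³` of the seed loss. -/
def IsSeedEstimator {n : ℕ} (S : Finset (Fin n)) (A Y Bt : Matrix (Fin n) (Fin n) ℝ)
    (θhat : Fin 3 → ℝ) : Prop :=
  ∀ θ : Fin 3 → ℝ, seedLoss S A Y Bt θhat ≤ seedLoss S A Y Bt θ

/-- `Qhat` minimizes `‖Phat - Q Bt Qᵀ‖²` over the permutation matrices `Q` with
`Q_{S,S} = I`. -/
def IsQAPSolution {n : ℕ} (S : Finset (Fin n)) (Phat Bt Qhat : Matrix (Fin n) (Fin n) ℝ) :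
    Prop :=
  IsSeededPerm S Qhat ∧
    ∀ Q : Matrix (Fin n) (Fin n) ℝ, IsSeededPerm S Q →
      frobSq (Phat - Qhat * Bt * Qhatᵀ) ≤ frobSq (Phat - Q * Bt * Qᵀ)

/-- `Qhat` is a seeded QAP estimator from the data `(A, Y, Bt)` and the seeds `S`: the linear
model is fitted on the seed pairs, the fitted matrix `Phat` is formed on all pairs, and
`Qhat` solves the quadratic assignment problem for `Phat`. -/
def IsSeededQAPEstimator {n : ℕ} (S : Finset (Fin n))
    (A Y Bt Qhat : Matrix (Fin n) (Fin n) ℝ) : Prop :=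
  ∃ θhat : Fin 3 → ℝ, IsSeedEstimator S A Y Bt θhat ∧
    IsQAPSolution S (linearMean A Y θhat) Bt Qhat

/-- The expected edge probability `θ₀ + θ₁ p + θ₂ q` of the second graph. -/
noncomputable def meanLevel (θ : Fin 3 → ℝ) (p q : ℝ) : ℝ := θ 0 + θ 1 * p + θ 2 * q

end CovMatching

/-! Expanding the squared norms, a wrong `Qhat` produces a vertex permutation `π ≠ 1` with `θhat 1 *
T₁ + θhat 2 * T₂ ≤ 0`, where `T₁` and `T₂` sum `(A e - A (π e)) * B e` and `(Y e - Y (π e)) * B e`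
over the `N` vertex pairs moved by `π` (`IsQAPSolution.exists_perm`); the intercept cancels. Put
`σ₁² = p(1-p)`, `σ₂² = q(1-q)` and `V² = θ₁²σ₁² + θ₂²σ₂²`. The means of `T₁` and `T₂` are `Nσ₁²θ₁`
and `Nσ₂²θ₂`, so at the true coefficients the comparison sum has mean `NV²`. It remains to control
the noise in the sums and the error of `θhat`.

Noise: a permutation moving `k` vertices moves at least `kn/4` pairs. The summands are dependent
along the cycles of the induced permutation of pairs, but a 3-colouring of these cycles splits the
sum into three sums of independent terms, and Bernstein's inequality bounds the probability of a
deviation of order `NσV` by `6n^(-3k)`. This survives a union bound over all `π ≠ 1`, at total cost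
`O(1/n)`.

Estimation: on the seed pairs the observed graph agrees with `B`. Chebyshev's inequality for eight
empirical moments and the basic inequality of least squares give `(θhat₁-θ₁)²σ₁² + (θhat₂-θ₂)²σ₂² ≤
V²/16` outside an event of probability `O(1/(s²τ) + 1/√(log s))` (`least_squares_error`,
`seed_error_le`).

Since `T₁` and `T₂` do not involve `θhat`, reusing the seed data in the matching step is harmless:
outside the exceptional events `comparison_pos` is purely deterministic. -/

namespace CovMatching

/-! ### Concentration for sums along a permutation of i.i.d. variables. -/

/-- A permutation of a finite type has a colouring with three colours in which every moved
point differs in colour from its image. -/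
theorem exists_three_coloring {ι : Type*} [Fintype ι] [DecidableEq ι] (ρ : Equiv.Perm ι) :
    ∃ c : ι → Fin 3, ∀ e, ρ e ≠ e → c e ≠ c (ρ e) := by
  -- Greedy colouring: a point constrains only its image and its preimage, so one of three colours
  -- is always free. Restricting the requirement to points and images inside `s` makes the induction
  -- work.
  suffices h : ∀ s : Finset ι, ∃ c : ι → Fin 3, ∀ e ∈ s, ρ e ∈ s → ρ e ≠ e → c e ≠ c (ρ e) by
    obtain ⟨c, hc⟩ := h Finset.univ
    exact ⟨c, fun e he => hc e (Finset.mem_univ _) (Finset.mem_univ _) he⟩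
  intro s
  induction s using Finset.induction_on with
  | empty => exact ⟨fun _ => 0, by simp⟩
  | insert a s ha ih =>
    obtain ⟨c, hc⟩ := ih
    obtain ⟨k, hk₁, hk₂⟩ : ∃ k : Fin 3, k ≠ c (ρ a) ∧ k ≠ c (ρ⁻¹ a) := by
      generalize c (ρ a) = x
      generalize c (ρ⁻¹ a) = y
      revert x y
      decide
    refine ⟨Function.update c a k, fun e he hρe hne => ?_⟩
    by_cases hea : e = a
    · subst hea
      rwa [Function.update_self, Function.update_of_ne hne]
    · rw [Function.update_of_ne hea]
      by_cases hρ : ρ e = a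
      · rw [hρ, Function.update_self]
        have : ρ⁻¹ a = e := by rw [← hρ]; simp
        rw [← this]
        exact hk₂.symm
      · rw [Function.update_of_ne hρ]
        exact hc e ((Finset.mem_insert.1 he).resolve_left hea)
          ((Finset.mem_insert.1 hρe).resolve_left hρ) hne

/-- The finitely valued random variables `Z e` are independent, and each has law `w`. -/
structure IsIIDWith {Ω ι T : Type*} [MeasurableSpace Ω] [Fintype T] [MeasurableSpace T]
    (μ : Measure Ω) (Z : ι → Ω → T) (w : T → ℝ) : Prop where
  measurable : ∀ e, Measurable (Z e)
  indep : iIndepFun Z μ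
  integral_comp : ∀ e (g : T → ℝ), ∫ ω, g (Z e ω) ∂μ = ∑ z, w z * g z

section IID

variable {Ω ι T : Type*} [MeasurableSpace Ω] [Fintype T] [MeasurableSpace T]
  [DiscreteMeasurableSpace T] {μ : Measure Ω} [IsProbabilityMeasure μ]
  {Z : ι → Ω → T} {w : T → ℝ}

theorem integrable_of_comp_finite {Ω T : Type*} [MeasurableSpace Ω] [Finite T]
    [MeasurableSpace T] [DiscreteMeasurableSpace T] {μ : Measure Ω} [IsProbabilityMeasure μ]
    {V : Ω → T} (hV : Measurable V) (g : T → ℝ) : Integrable (fun ω => g (V ω)) μ := by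
  have hm : Measurable (fun ω => g (V ω)) := (Measurable.of_discrete (f := g)).comp hV
  obtain ⟨C, hC⟩ := (Set.finite_range (fun z => ‖g z‖)).bddAbove
  exact Integrable.of_bound hm.aestronglyMeasurable C
    (Eventually.of_forall fun ω => hC ⟨V ω, rfl⟩)

/-- Splitting according to the value of `Z e` reduces the claim to products of functions of the two
independent variables separately. -/
theorem IsIIDWith.integral_pair (h : IsIIDWith μ Z w) {e e' : ι} (hne : e ≠ e')
    (F : T → T → ℝ) :
    ∫ ω, F (Z e ω) (Z e' ω) ∂μ = ∑ z, ∑ z', w z * w z' * F z z' := by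
  classical
  have hind := h.indep.indepFun hne
  have hsplit : ∀ ω, F (Z e ω) (Z e' ω) =
      ∑ a, (if Z e ω = a then (1 : ℝ) else 0) * F a (Z e' ω) := by
    intro ω
    simp
  simp_rw [hsplit]
  have hpair : Measurable fun ω => (Z e ω, Z e' ω) := (h.measurable e).prodMk (h.measurable e')
  rw [integral_finsetSum _ fun a _ => integrable_of_comp_finite hpair
    (fun z => (if z.1 = a then (1 : ℝ) else 0) * F a z.2)]
  refine Finset.sum_congr rfl fun a _ => ?_
  have hi : IndepFun (fun ω => if Z e ω = a then (1 : ℝ) else 0) (fun ω => F a (Z e' ω)) μ :=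
    hind.comp (φ := fun z => if z = a then (1 : ℝ) else 0) (ψ := fun z => F a z)
      Measurable.of_discrete Measurable.of_discrete
  have := hi.integral_fun_mul_eq_mul_integral
    (integrable_of_comp_finite (h.measurable e)
      (fun z => if z = a then (1 : ℝ) else 0)).aestronglyMeasurable
    (integrable_of_comp_finite (h.measurable e') (F a)).aestronglyMeasurable
  rw [this, h.integral_comp e (fun z => if z = a then (1 : ℝ) else 0), h.integral_comp e' (F a)]
  simp [Finset.mul_sum, mul_assoc]

/-- As `C` misses its image, the index pairs `{e, ρ e}` are pairwise disjoint, so the factors are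
independent; the induction peels off one at a time. -/
theorem IsIIDWith.integral_prod_pairs [DecidableEq ι] (h : IsIIDWith μ Z w) (ρ : Equiv.Perm ι)
    (C : Finset ι) (hC : ∀ e ∈ C, ∀ e' ∈ C, ρ e ≠ e') (H : T → T → ℝ) :
    ∫ ω, ∏ e ∈ C, H (Z e ω) (Z (ρ e) ω) ∂μ =
      (∑ z, ∑ z', w z * w z' * H z z') ^ C.card := by
  induction C using Finset.induction_on with
  | empty => simp
  | insert a C ha ih =>
    have hC' : ∀ e ∈ C, ∀ e' ∈ C, ρ e ≠ e' := fun e he e' he' =>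
      hC e (Finset.mem_insert_of_mem he) e' (Finset.mem_insert_of_mem he')
    have haa : a ≠ ρ a :=
      (hC a (Finset.mem_insert_self _ _) a (Finset.mem_insert_self _ _)).symm
    simp_rw [Finset.prod_insert ha]
    rw [Finset.card_insert_of_notMem ha, pow_succ', ← ih hC', ← h.integral_pair haa H]
    set S₁ : Finset ι := {a, ρ a}
    set S₂ : Finset ι := C ∪ C.image ρ
    have hdisj : Disjoint S₁ S₂ := by
      rw [Finset.disjoint_left]
      intro x hx hx'
      simp only [S₁, S₂, Finset.mem_insert, Finset.mem_singleton, Finset.mem_union,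
        Finset.mem_image] at hx hx'
      rcases hx with rfl | rfl
      · rcases hx' with hx' | ⟨y, hy, hyx⟩
        · exact ha hx'
        · exact hC y (Finset.mem_insert_of_mem hy) x (Finset.mem_insert_self _ _) hyx
      · rcases hx' with hx' | ⟨y, hy, hyx⟩
        · exact hC a (Finset.mem_insert_self _ _) _ (Finset.mem_insert_of_mem hx') rfl
        · exact ha (ρ.injective hyx ▸ hy)
    have hI := h.indep.indepFun_finset S₁ S₂ hdisj h.measurable
    have ha₁ : a ∈ S₁ := by simp [S₁]
    have ha₂ : ρ a ∈ S₁ := by simp [S₁]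
    have hc₁ : ∀ e ∈ C, e ∈ S₂ := fun e he => Finset.mem_union_left _ he
    have hc₂ : ∀ e ∈ C, ρ e ∈ S₂ := fun e he =>
      Finset.mem_union_right _ (Finset.mem_image_of_mem _ he)
    have hI' := hI.comp (φ := fun z : S₁ → T => H (z ⟨a, ha₁⟩) (z ⟨ρ a, ha₂⟩))
      (ψ := fun z : S₂ → T => ∏ e ∈ C.attach,
        H (z ⟨e.1, hc₁ e.1 e.2⟩) (z ⟨ρ e.1, hc₂ e.1 e.2⟩))
      Measurable.of_discrete Measurable.of_discrete
    have hm₁ : Measurable fun ω (i : S₁) => Z i ω := measurable_pi_lambda _ fun i => h.measurable i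
    have hm₂ : Measurable fun ω (i : S₂) => Z i ω := measurable_pi_lambda _ fun i => h.measurable i
    have key := hI'.integral_fun_mul_eq_mul_integral
      (Measurable.of_discrete.comp hm₁).aestronglyMeasurable
      (Measurable.of_discrete.comp hm₂).aestronglyMeasurable
    simp only [Function.comp_apply] at key
    have hatt : ∀ ω, ∏ e ∈ C.attach, H (Z e.1 ω) (Z (ρ e.1) ω) =
        ∏ e ∈ C, H (Z e ω) (Z (ρ e) ω) := fun ω =>
      Finset.prod_attach C fun e => H (Z e ω) (Z (ρ e) ω)
    simp_rw [hatt] at key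
    exact key

/-- Bernstein's inequality for sums of `F (Z e) (Z (ρ e))` over a set of indices that is
disjoint from its image. -/
theorem IsIIDWith.bernstein_of_disjoint [DecidableEq ι] (h : IsIIDWith μ Z w)
    (hw : ∀ z, 0 ≤ w z) (hw1 : ∑ z, w z = 1) (ρ : Equiv.Perm ι)
    (C : Finset ι) (hC : ∀ e ∈ C, ∀ e' ∈ C, ρ e ≠ e') (F : T → T → ℝ)
    (hF : ∀ z z', |F z z'| ≤ 1) {μ₀ v t l : ℝ}
    (hmean : ∑ z, ∑ z', w z * w z' * F z z' = μ₀)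
    (hvar : ∑ z, ∑ z', w z * w z' * F z z' ^ 2 ≤ v) (hl0 : 0 ≤ l) (hl1 : l ≤ 1) :
    μ.real {ω | C.card * μ₀ + t ≤ ∑ e ∈ C, F (Z e ω) (Z (ρ e) ω)} ≤
      Real.exp (-(l * t) + l ^ 2 * (C.card * v)) := by
  have hmZ : Measurable fun ω (e : C) => (Z e ω, Z (ρ e) ω) :=
    measurable_pi_lambda _ fun e => (h.measurable e).prodMk (h.measurable (ρ e))
  have hatt : ∀ ω, ∑ e ∈ C.attach, F (Z e ω) (Z (ρ e) ω) = ∑ e ∈ C, F (Z e ω) (Z (ρ e) ω) :=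
    fun ω => Finset.sum_attach C fun e => F (Z e ω) (Z (ρ e) ω)
  have hint : Integrable (fun ω => Real.exp (l * ∑ e ∈ C, F (Z e ω) (Z (ρ e) ω))) μ := by
    have := integrable_of_comp_finite (μ := μ) hmZ
      (fun z => Real.exp (l * ∑ e ∈ C.attach, F (z e).1 (z e).2))
    simpa only [hatt] using this
  have hmgf : mgf (fun ω => ∑ e ∈ C, F (Z e ω) (Z (ρ e) ω)) μ l ≤
      Real.exp (l * μ₀ + l ^ 2 * v) ^ C.card := by
    have : mgf (fun ω => ∑ e ∈ C, F (Z e ω) (Z (ρ e) ω)) μ l =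
        ∫ ω, ∏ e ∈ C, Real.exp (l * F (Z e ω) (Z (ρ e) ω)) ∂μ := by
      simp only [mgf, Finset.mul_sum, Real.exp_sum]
    rw [this, h.integral_prod_pairs ρ C hC (fun z z' => Real.exp (l * F z z'))]
    refine pow_le_pow_left₀ (Finset.sum_nonneg fun z _ => Finset.sum_nonneg fun z' _ =>
      mul_nonneg (mul_nonneg (hw z) (hw z')) (Real.exp_pos _).le) ?_ _
    -- The bound `exp x ≤ 1 + x + x²` for `|x| ≤ 1`; this is where `|F| ≤ 1` and `l ≤ 1` enter.
    have hpt : ∀ z z', Real.exp (l * F z z') ≤ 1 + l * F z z' + l ^ 2 * F z z' ^ 2 := by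
      intro z z'
      have habs : |l * F z z'| ≤ 1 := by
        rw [abs_mul, abs_of_nonneg hl0]
        exact mul_le_one₀ hl1 (abs_nonneg _) (hF z z')
      have := (abs_le.1 (Real.abs_exp_sub_one_sub_id_le habs)).2
      rw [mul_pow] at this
      linarith
    calc ∑ z, ∑ z', w z * w z' * Real.exp (l * F z z')
        ≤ ∑ z, ∑ z', w z * w z' * (1 + l * F z z' + l ^ 2 * F z z' ^ 2) :=
          Finset.sum_le_sum fun z _ => Finset.sum_le_sum fun z' _ =>
            mul_le_mul_of_nonneg_left (hpt z z') (mul_nonneg (hw z) (hw z'))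
      _ = (∑ z, w z) * (∑ z, w z) + l * ∑ z, ∑ z', w z * w z' * F z z' +
            l ^ 2 * ∑ z, ∑ z', w z * w z' * F z z' ^ 2 := by
          rw [Finset.sum_mul_sum]
          simp only [Finset.mul_sum, ← Finset.sum_add_distrib]
          refine Finset.sum_congr rfl fun z _ => Finset.sum_congr rfl fun z' _ => ?_
          ring
      _ ≤ l * μ₀ + l ^ 2 * v + 1 := by
          rw [hw1, hmean]
          nlinarith [mul_le_mul_of_nonneg_left hvar (sq_nonneg l)]
      _ ≤ _ := Real.add_one_le_exp _
  refine (measure_ge_le_exp_mul_mgf _ hl0 hint).trans ?_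
  refine (mul_le_mul_of_nonneg_left hmgf (Real.exp_pos _).le).trans ?_
  rw [← Real.exp_nat_mul, ← Real.exp_add]
  refine le_of_eq ?_
  congr 1
  ring

/-- Bernstein's inequality for sums of `F (Z e) (Z (ρ e))` over the indices moved by `ρ`. -/
theorem IsIIDWith.bernstein_moved [Fintype ι] [DecidableEq ι] (h : IsIIDWith μ Z w)
    (hw : ∀ z, 0 ≤ w z) (hw1 : ∑ z, w z = 1) (ρ : Equiv.Perm ι) (F : T → T → ℝ)
    (hF : ∀ z z', |F z z'| ≤ 1) {μ₀ v t l : ℝ}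
    (hmean : ∑ z, ∑ z', w z * w z' * F z z' = μ₀)
    (hvar : ∑ z, ∑ z', w z * w z' * F z z' ^ 2 ≤ v) (hv : 0 ≤ v) (hl0 : 0 ≤ l) (hl1 : l ≤ 1) :
    μ.real {ω | ρ.support.card * μ₀ + 3 * t ≤ ∑ e ∈ ρ.support, F (Z e ω) (Z (ρ e) ω)} ≤
      3 * Real.exp (-(l * t) + l ^ 2 * (ρ.support.card * v)) := by
  obtain ⟨c, hc⟩ := exists_three_coloring ρ
  set C : Fin 3 → Finset ι := fun k => ρ.support.filter fun e => c e = k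
  have hsum : ∀ f : ι → ℝ, ∑ k, ∑ e ∈ C k, f e = ∑ e ∈ ρ.support, f e := fun f =>
    Finset.sum_fiberwise _ c f
  have hcard : ∑ k, ((C k).card : ℝ) = ρ.support.card := by
    simpa using hsum fun _ => 1
  -- An excess of `3t` in the whole sum forces an excess of `t` in one of the three colour classes.
  have hsub : {ω | ρ.support.card * μ₀ + 3 * t ≤ ∑ e ∈ ρ.support, F (Z e ω) (Z (ρ e) ω)} ⊆
      ⋃ k, {ω | (C k).card * μ₀ + t ≤ ∑ e ∈ C k, F (Z e ω) (Z (ρ e) ω)} := by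
    intro ω hω
    by_contra hcon
    simp only [Set.mem_iUnion, Set.mem_ofPred_eq, not_exists, not_le] at hcon hω
    have := Finset.sum_lt_sum_of_nonempty (s := (Finset.univ : Finset (Fin 3)))
      Finset.univ_nonempty fun k _ => hcon k
    rw [hsum fun e => F (Z e ω) (Z (ρ e) ω), Finset.sum_add_distrib, ← Finset.sum_mul, hcard]
      at this
    simp at this
    linarith
  refine (measureReal_mono hsub).trans ((measureReal_iUnion_fintype_le _).trans ?_)
  have hb : ∀ k, μ.real {ω | (C k).card * μ₀ + t ≤ ∑ e ∈ C k, F (Z e ω) (Z (ρ e) ω)} ≤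
      Real.exp (-(l * t) + l ^ 2 * (ρ.support.card * v)) := by
    intro k
    refine (h.bernstein_of_disjoint hw hw1 ρ (C k) ?_ F hF hmean hvar hl0 hl1).trans ?_
    · intro e he e' he' heq
      simp only [C, Finset.mem_filter, Equiv.Perm.mem_support] at he he'
      exact hc e he.1 (by rw [heq, he.2, he'.2])
    · have : ((C k).card : ℝ) ≤ ρ.support.card := by
        exact_mod_cast Finset.card_le_card (Finset.filter_subset _ _)
      gcongr
  refine (Finset.sum_le_sum fun k _ => hb k).trans ?_
  simp

/-- The second moment of a sum of independent centred variables. -/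
theorem IsIIDWith.integral_sum_sq [DecidableEq ι] (h : IsIIDWith μ Z w) (C : Finset ι)
    (g : T → ℝ) (hg : ∑ z, w z * g z = 0) :
    ∫ ω, (∑ e ∈ C, g (Z e ω)) ^ 2 ∂μ = C.card * ∑ z, w z * g z ^ 2 := by
  have hpair : ∀ e e' : ι, Integrable (fun ω => g (Z e ω) * g (Z e' ω)) μ := fun e e' =>
    integrable_of_comp_finite ((h.measurable e).prodMk (h.measurable e'))
      (fun z => g z.1 * g z.2)
  simp_rw [pow_two (∑ e ∈ C, _), Finset.sum_mul_sum]
  rw [integral_finsetSum _ fun e _ => integrable_finsetSum _ fun e' _ => hpair e e']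
  have : ∀ e ∈ C, ∫ ω, ∑ e' ∈ C, g (Z e ω) * g (Z e' ω) ∂μ = ∑ z, w z * g z ^ 2 := by
    intro e he
    rw [integral_finsetSum _ fun e' _ => hpair e e', Finset.sum_eq_single_of_mem e he]
    · simpa only [← pow_two] using h.integral_comp e (fun z => g z ^ 2)
    · intro e' _ hne
      rw [h.integral_pair hne.symm fun z z' => g z * g z']
      have : ∑ z, ∑ z', w z * w z' * (g z * g z') = (∑ z, w z * g z) * ∑ z, w z * g z := by
        rw [Finset.sum_mul_sum]
        exact Finset.sum_congr rfl fun z _ => Finset.sum_congr rfl fun z' _ => by ring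
      rw [this, hg, zero_mul]
  rw [Finset.sum_congr rfl this]
  simp

/-- Used on the seed pairs, where only finitely many events must be excluded; no union over
permutations occurs there, so second moments suffice. -/
theorem IsIIDWith.chebyshev [DecidableEq ι] (h : IsIIDWith μ Z w) (C : Finset ι)
    (g : T → ℝ) (hg : ∑ z, w z * g z = 0) {v r : ℝ} (hv : ∑ z, w z * g z ^ 2 ≤ v)
    (hr : 0 < r) :
    μ.real {ω | r ≤ (∑ e ∈ C, g (Z e ω)) ^ 2} ≤ C.card * v / r := by
  have hint : Integrable (fun ω => (∑ e ∈ C, g (Z e ω)) ^ 2) μ := by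
    have hmZ : Measurable fun ω (e : C) => Z e ω :=
      measurable_pi_lambda _ fun e => h.measurable e
    have := integrable_of_comp_finite (μ := μ) hmZ (fun z => (∑ e ∈ C.attach, g (z e)) ^ 2)
    have hatt : ∀ ω, ∑ e ∈ C.attach, g (Z e ω) = ∑ e ∈ C, g (Z e ω) :=
      fun ω => Finset.sum_attach C fun e => g (Z e ω)
    simpa only [hatt] using this
  have := mul_meas_ge_le_integral_of_nonneg
    (Eventually.of_forall fun ω => sq_nonneg (∑ e ∈ C, g (Z e ω))) hint r
  rw [h.integral_sum_sq C g hg] at this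
  rw [le_div_iff₀ hr, mul_comm]
  exact this.trans (mul_le_mul_of_nonneg_left hv (Nat.cast_nonneg _))

end IID

/-! ### Counting permutations by their moved points. -/

/-- The generating function of the number of moved points of a permutation. -/
theorem sum_pow_card_support_le (n : ℕ) {x : ℝ} (hx : 0 ≤ x) :
    ∑ σ ∈ (Finset.univ : Finset (Equiv.Perm (Fin n))).erase 1, x ^ σ.support.card ≤
      (1 + n * x) ^ n - 1 := by
  -- Permutations are enlarged to all self-maps, for which the sum factorizes over the points.
  have hfun : ∑ f : Fin n → Fin n, ∏ i, (if f i = i then (1 : ℝ) else x) ≤ (1 + n * x) ^ n := by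
    have := Finset.prod_univ_sum (fun _ : Fin n => (Finset.univ : Finset (Fin n)))
      (fun i j => if j = i then (1 : ℝ) else x)
    rw [Fintype.piFinset_univ] at this
    rw [← this]
    have hle : ∀ i : Fin n, ∑ j : Fin n, (if j = i then (1 : ℝ) else x) ≤ 1 + n * x := by
      intro i
      calc ∑ j : Fin n, (if j = i then (1 : ℝ) else x)
          ≤ ∑ j : Fin n, ((if j = i then (1 : ℝ) else 0) + x) :=
            Finset.sum_le_sum fun j _ => by split_ifs <;> linarith
        _ = 1 + n * x := by simp [Finset.sum_add_distrib]
    calc ∏ i : Fin n, ∑ j : Fin n, (if j = i then (1 : ℝ) else x)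
        ≤ ∏ _i : Fin n, (1 + n * x) := Finset.prod_le_prod
          (fun i _ => Finset.sum_nonneg fun j _ => by split_ifs <;> linarith) fun i _ => hle i
      _ = _ := by simp
  have hterm : ∀ σ : Equiv.Perm (Fin n),
      x ^ σ.support.card = ∏ i, (if σ i = i then (1 : ℝ) else x) := by
    intro σ
    rw [Finset.prod_ite, Finset.prod_const_one, one_mul, Finset.prod_const]
    rfl
  have hperm : ∑ σ : Equiv.Perm (Fin n), x ^ σ.support.card ≤
      ∑ f : Fin n → Fin n, ∏ i, (if f i = i then (1 : ℝ) else x) := by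
    simp_rw [hterm]
    rw [← Finset.sum_image (s := (Finset.univ : Finset (Equiv.Perm (Fin n))))
      (g := fun σ : Equiv.Perm (Fin n) => (σ : Fin n → Fin n))
      (f := fun f => ∏ i, (if f i = i then (1 : ℝ) else x))
      (fun σ _ τ _ hστ => Equiv.coe_fn_injective hστ)]
    exact Finset.sum_le_sum_of_subset_of_nonneg (Finset.subset_univ _) fun f _ _ =>
      Finset.prod_nonneg fun i _ => by split_ifs <;> linarith
  have := Finset.sum_erase_add (Finset.univ : Finset (Equiv.Perm (Fin n)))
    (fun σ => x ^ σ.support.card) (Finset.mem_univ 1)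
  simp only [Equiv.Perm.support_one, Finset.card_empty, pow_zero] at this
  linarith

/-! ### The joint law of the edge triples. -/

/-- The value of a truth value as a real number. -/
noncomputable def bit (b : Bool) : ℝ := if b then 1 else 0

@[simp] theorem bit_true : bit true = 1 := rfl

@[simp] theorem bit_false : bit false = 0 := by simp [bit]

/-- The joint law of the entries of `(A, Y, B)` at a pair of vertices. -/
noncomputable def tripleWeight (p q : ℝ) (θ : Fin 3 → ℝ) (z : Bool × Bool × Bool) : ℝ :=
  (if z.1 then p else 1 - p) * (if z.2.1 then q else 1 - q) *
    (if z.2.2 then θ 0 + θ 1 * bit z.1 + θ 2 * bit z.2.1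
      else 1 - (θ 0 + θ 1 * bit z.1 + θ 2 * bit z.2.1))

theorem sum_triple (f : Bool × Bool × Bool → ℝ) :
    ∑ z, f z = f (true, true, true) + f (true, true, false) + f (true, false, true) +
      f (true, false, false) + f (false, true, true) + f (false, true, false) +
      f (false, false, true) + f (false, false, false) := by
  simp [Fintype.sum_prod_type]
  ring

theorem sum_tripleWeight (p q : ℝ) (θ : Fin 3 → ℝ) : ∑ z, tripleWeight p q θ z = 1 := by
  rw [sum_triple]
  simp [tripleWeight]
  ring

theorem tripleWeight_nonneg {p q : ℝ} {θ : Fin 3 → ℝ} (hp : p ∈ Set.Ioo (0 : ℝ) 1)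
    (hq : q ∈ Set.Ioo (0 : ℝ) 1)
    (hθ : ∀ a ∈ ({0, 1} : Set ℝ), ∀ y ∈ ({0, 1} : Set ℝ),
      θ 0 + θ 1 * a + θ 2 * y ∈ Set.Icc (0 : ℝ) 1) (z : Bool × Bool × Bool) :
    0 ≤ tripleWeight p q θ z := by
  have hb : ∀ b, bit b ∈ ({0, 1} : Set ℝ) := fun b => by cases b <;> simp
  have := hθ _ (hb z.1) _ (hb z.2.1)
  refine mul_nonneg (mul_nonneg ?_ ?_) ?_
  · split_ifs <;> linarith [hp.1, hp.2]
  · split_ifs <;> linarith [hq.1, hq.2]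
  · split_ifs <;> linarith [this.1, this.2]

/-- The triple of entries of `(A, Y, B)` at a pair of vertices. -/
noncomputable def edgeTriple {n : ℕ} (A Y B : Matrix (Fin n) (Fin n) ℝ) (e : Pairs n) :
    Bool × Bool × Bool :=
  (decide (A e.1.1 e.1.2 = 1), decide (Y e.1.1 e.1.2 = 1), decide (B e.1.1 e.1.2 = 1))

/-- The symmetric matrix with zero diagonal and prescribed entries below the diagonal. -/
noncomputable def symmOfPairs {n : ℕ} (f : Pairs n → ℝ) : Matrix (Fin n) (Fin n) ℝ :=
  Matrix.of fun i j => if h : j < i then f ⟨(i, j), h⟩ else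
    if h : i < j then f ⟨(j, i), h⟩ else 0

theorem symmOfPairs_apply {n : ℕ} (f : Pairs n → ℝ) (e : Pairs n) :
    symmOfPairs f e.1.1 e.1.2 = f e := by
  simp only [symmOfPairs, Matrix.of_apply]
  rw [dif_pos e.2]

theorem symmOfPairs_isAdjMatrix {n : ℕ} {f : Pairs n → ℝ} (hf : ∀ e, f e = 0 ∨ f e = 1) :
    (symmOfPairs f).IsAdjMatrix where
  zero_or_one i j := by
    simp only [symmOfPairs, Matrix.of_apply]
    split_ifs
    · exact hf _
    · exact hf _
    · exact Or.inl rfl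
  symm := by
    ext i j
    simp only [symmOfPairs, Matrix.of_apply, Matrix.transpose_apply]
    rcases lt_trichotomy i j with h | h | h
    · rw [dif_pos h, dif_neg h.not_gt, dif_pos h]
    · subst h; rfl
    · rw [dif_neg h.not_gt, dif_pos h, dif_pos h]
  apply_diag i := by simp [symmOfPairs]

theorem _root_.Matrix.IsAdjMatrix.eq_symmOfPairs_iff {n : ℕ} {M : Matrix (Fin n) (Fin n) ℝ}
    (hM : M.IsAdjMatrix) (f : Pairs n → ℝ) :
    M = symmOfPairs f ↔ ∀ e : Pairs n, M e.1.1 e.1.2 = f e := by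
  constructor
  · rintro rfl e
    exact symmOfPairs_apply f e
  · intro h
    ext i j
    simp only [symmOfPairs, Matrix.of_apply]
    rcases lt_trichotomy i j with hij | hij | hij
    · rw [dif_neg hij.not_gt, dif_pos hij, ← h ⟨(j, i), hij⟩, hM.symm.apply]
    · subst hij
      rw [dif_neg (lt_irrefl _), dif_neg (lt_irrefl _), hM.apply_diag]
    · rw [dif_pos hij, ← h ⟨(i, j), hij⟩]

theorem _root_.Matrix.IsAdjMatrix.apply_eq_bit {n : ℕ} {M : Matrix (Fin n) (Fin n) ℝ}
    (hM : M.IsAdjMatrix) (i j : Fin n) : M i j = bit (decide (M i j = 1)) := by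
  rcases hM.zero_or_one i j with h | h <;> simp [h]

theorem _root_.Matrix.IsAdjMatrix.apply_eq_bit_iff {n : ℕ} {M : Matrix (Fin n) (Fin n) ℝ}
    (hM : M.IsAdjMatrix) (i j : Fin n) (b : Bool) : M i j = bit b ↔ decide (M i j = 1) = b := by
  rcases hM.zero_or_one i j with h | h <;> cases b <;> simp [h]

theorem linearMean_apply {n : ℕ} (A Y : Matrix (Fin n) (Fin n) ℝ) (θ : Fin 3 → ℝ) {i j : Fin n}
    (h : i ≠ j) : linearMean A Y θ i j = θ 0 + θ 1 * A i j + θ 2 * Y i j := by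
  simp [linearMean, predictor, h, dotProduct, Fin.sum_univ_three]
  ring

section Law

variable {Ω : Type*} [MeasurableSpace Ω] {μ : Measure Ω} [IsProbabilityMeasure μ] {n : ℕ}
  {A Y B : Ω → Matrix (Fin n) (Fin n) ℝ} {p q : ℝ} {θ : Fin 3 → ℝ}

theorem IsER.measure_eq (hA : IsER μ A p) (hp : p ∈ Set.Ioo (0 : ℝ) 1) (x : Pairs n → Bool) :
    μ {ω | A ω = symmOfPairs fun e => bit (x e)} =
      ∏ e, ENNReal.ofReal (if x e then p else 1 - p) := by
  have hset : {ω | A ω = symmOfPairs fun e => bit (x e)} =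
      ⋂ e ∈ (Finset.univ : Finset (Pairs n)),
        (fun ω => A ω e.1.1 e.1.2) ⁻¹' {bit (x e)} := by
    ext ω
    simp only [Set.mem_ofPred_eq, (hA.isAdj ω).eq_symmOfPairs_iff, Finset.mem_univ,
      Set.iInter_true, Set.mem_iInter, Set.mem_preimage, Set.mem_singleton_iff]
  rw [hset, hA.indep.measure_inter_preimage_eq_mul _ fun e _ => measurableSet_singleton _]
  refine Finset.prod_congr rfl fun e _ => ?_
  cases hx : x e
  · have hc : (fun ω => A ω e.1.1 e.1.2) ⁻¹' {bit false} = {ω | A ω e.1.1 e.1.2 = 1}ᶜ := by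
      ext ω
      rcases (hA.isAdj ω).zero_or_one e.1.1 e.1.2 with h | h <;> simp [h]
    have hm : MeasurableSet {ω | A ω e.1.1 e.1.2 = 1} :=
      hA.measurable _ _ (measurableSet_singleton (1 : ℝ))
    rw [hc, prob_compl_eq_one_sub hm, hA.prob e, ← ENNReal.ofReal_one,
      ← ENNReal.ofReal_sub _ hp.1.le]
    simp
  · rw [bit_true, if_pos rfl]
    exact hA.prob e

/-- Prescribing all triples fixes the three adjacency matrices; the laws of `A` and `Y` and the
conditional law of `B` are each products over pairs. -/
theorem measure_edgeTriple_eq (hp : p ∈ Set.Ioo (0 : ℝ) 1) (hq : q ∈ Set.Ioo (0 : ℝ) 1)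
    (hA : IsER μ A p) (hY : IsER μ Y q)
    (hAY : IndepFun (fun ω (i j : Fin n) => A ω i j) (fun ω (i j : Fin n) => Y ω i j) μ)
    (hB : IsBernoulliResponse μ A Y B θ) (x : Pairs n → Bool × Bool × Bool) :
    μ {ω | (fun e => edgeTriple (A ω) (Y ω) (B ω) e) = x} =
      ∏ e, ENNReal.ofReal (tripleWeight p q θ (x e)) := by
  set a : Matrix (Fin n) (Fin n) ℝ := symmOfPairs fun e => bit (x e).1
  set y : Matrix (Fin n) (Fin n) ℝ := symmOfPairs fun e => bit (x e).2.1
  set b : Matrix (Fin n) (Fin n) ℝ := symmOfPairs fun e => bit (x e).2.2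
  have hbit : ∀ c, bit c = 0 ∨ bit c = 1 := fun c => by cases c <;> simp
  have hset : {ω | (fun e => edgeTriple (A ω) (Y ω) (B ω) e) = x} =
      {ω | A ω = a ∧ Y ω = y ∧ B ω = b} := by
    ext ω
    simp only [Set.mem_ofPred_eq, a, y, b, (hA.isAdj ω).eq_symmOfPairs_iff,
      (hY.isAdj ω).eq_symmOfPairs_iff, (hB.isAdj ω).eq_symmOfPairs_iff, funext_iff, edgeTriple,
      (hA.isAdj ω).apply_eq_bit_iff, (hY.isAdj ω).apply_eq_bit_iff,
      (hB.isAdj ω).apply_eq_bit_iff, Prod.ext_iff, forall_and]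
  have hAY' : μ {ω | A ω = a ∧ Y ω = y} = μ {ω | A ω = a} * μ {ω | Y ω = y} :=
    hAY.measure_inter_preimage_eq_mul {a} {y}
      (measurableSet_singleton (α := Fin n → Fin n → ℝ) a)
      (measurableSet_singleton (α := Fin n → Fin n → ℝ) y)
  rw [hset, hB.condLaw a y b (symmOfPairs_isAdjMatrix fun e => hbit _)
    (symmOfPairs_isAdjMatrix fun e => hbit _) (symmOfPairs_isAdjMatrix fun e => hbit _), hAY',
    hA.measure_eq hp, hY.measure_eq hq, ← Finset.prod_mul_distrib, ← Finset.prod_mul_distrib]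
  refine Finset.prod_congr rfl fun e _ => ?_
  have hp0 : 0 ≤ if (x e).1 = true then p else 1 - p := by
    split_ifs <;> linarith [hp.1, hp.2]
  have hq0 : 0 ≤ if (x e).2.1 = true then q else 1 - q := by
    split_ifs <;> linarith [hq.1, hq.2]
  have ha : a e.1.1 e.1.2 = bit (x e).1 := symmOfPairs_apply _ e
  have hy : y e.1.1 e.1.2 = bit (x e).2.1 := symmOfPairs_apply _ e
  have hb : b e.1.1 e.1.2 = bit (x e).2.2 := symmOfPairs_apply _ e
  rw [← ENNReal.ofReal_mul hp0, ← ENNReal.ofReal_mul (mul_nonneg hp0 hq0), tripleWeight,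
    linearMean_apply a y θ e.2.ne', ha, hy, hb]
  congr 2
  cases (x e).2.2 <;> simp

/-- A law on a finite product is determined by its point masses, so the joint law is a product
measure; independence and the marginals are read off from it. -/
theorem isIIDWith_edgeTriple (hp : p ∈ Set.Ioo (0 : ℝ) 1) (hq : q ∈ Set.Ioo (0 : ℝ) 1)
    (hθ : ∀ a ∈ ({0, 1} : Set ℝ), ∀ y ∈ ({0, 1} : Set ℝ),
      θ 0 + θ 1 * a + θ 2 * y ∈ Set.Icc (0 : ℝ) 1)
    (hA : IsER μ A p) (hY : IsER μ Y q)
    (hAY : IndepFun (fun ω (i j : Fin n) => A ω i j) (fun ω (i j : Fin n) => Y ω i j) μ)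
    (hB : IsBernoulliResponse μ A Y B θ) :
    IsIIDWith μ (fun e ω => edgeTriple (A ω) (Y ω) (B ω) e) (tripleWeight p q θ) := by
  have hw := tripleWeight_nonneg hp hq hθ
  have hmeas : ∀ e : Pairs n, Measurable fun ω => edgeTriple (A ω) (Y ω) (B ω) e := by
    have hdec : ∀ {M : Ω → Matrix (Fin n) (Fin n) ℝ} (e : Pairs n),
        (∀ i j, Measurable fun ω => M ω i j) →
        Measurable fun ω => decide (M ω e.1.1 e.1.2 = 1) := fun e hM =>
      measurable_to_bool <| by
        convert hM e.1.1 e.1.2 (measurableSet_singleton (1 : ℝ)) using 1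
        ext ω
        simp
    exact fun e => (hdec e hA.measurable).prodMk
      ((hdec e hY.measurable).prodMk (hdec e hB.measurable))
  let P : PMF (Bool × Bool × Bool) :=
    PMF.ofFintype (fun z => ENNReal.ofReal (tripleWeight p q θ z)) (by
      rw [← ENNReal.ofReal_sum_of_nonneg fun z _ => hw z, sum_tripleWeight, ENNReal.ofReal_one])
  have hP : ∀ z, P.toMeasure {z} = ENNReal.ofReal (tripleWeight p q θ z) := fun z => by
    rw [PMF.toMeasure_apply_singleton _ _ (measurableSet_singleton z)]
    rfl
  have hpi : μ.map (fun ω e => edgeTriple (A ω) (Y ω) (B ω) e) =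
      Measure.pi fun _ : Pairs n => P.toMeasure := by
    refine Measure.ext_of_singleton fun x => ?_
    rw [Measure.map_apply (measurable_pi_lambda _ hmeas) (measurableSet_singleton x),
      Measure.pi_singleton]
    simp_rw [hP]
    exact measure_edgeTriple_eq hp hq hA hY hAY hB x
  have hmap : ∀ e : Pairs n, μ.map (fun ω => edgeTriple (A ω) (Y ω) (B ω) e) = P.toMeasure := by
    intro e
    have := (measurePreserving_eval (fun _ : Pairs n => P.toMeasure) e).map_eq
    rw [← hpi, Measure.map_map (measurable_pi_apply e) (measurable_pi_lambda _ hmeas)] at this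
    exact this
  refine ⟨hmeas, ?_, fun e g => ?_⟩
  · rw [iIndepFun_iff_map_fun_eq_pi_map fun e => (hmeas e).aemeasurable, hpi]
    simp_rw [hmap]
  · rw [← integral_map (hmeas e).aemeasurable
      (Measurable.of_discrete (f := g)).aestronglyMeasurable, hmap e,
      integral_fintype (Integrable.of_finite)]
    refine Finset.sum_congr rfl fun z _ => ?_
    rw [measureReal_def, hP, ENNReal.toReal_ofReal (hw z), smul_eq_mul]

end Law

/-! ### Vertex pairs and the permutations induced on them. -/

section Pairs

variable {n : ℕ}

theorem sum_pairs_eq (f : Fin n → Fin n → ℝ) :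
    ∑ e : Pairs n, f e.1.1 e.1.2 = ∑ i, ∑ j, if j < i then f i j else 0 := by
  rw [← Fintype.sum_prod_type' (fun i j => if j < i then f i j else 0), ← Finset.sum_filter]
  exact (Finset.sum_subtype (Finset.univ.filter fun x : Fin n × Fin n => x.2 < x.1)
    (fun x => by simp) fun x => f x.1 x.2).symm

theorem sum_eq_sum_diag_add_sum_pairs (f : Fin n → Fin n → ℝ) :
    ∑ i, ∑ j, f i j = ∑ i, f i i + ∑ e : Pairs n, (f e.1.1 e.1.2 + f e.1.2 e.1.1) := by
  rw [Finset.sum_add_distrib, sum_pairs_eq f, sum_pairs_eq fun i j => f j i,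
    Finset.sum_comm (f := fun i j => if j < i then f j i else 0), ← Finset.sum_add_distrib,
    ← Finset.sum_add_distrib]
  refine Finset.sum_congr rfl fun i _ => ?_
  have : f i i = ∑ j, if j = i then f i j else 0 := by simp
  rw [this, ← Finset.sum_add_distrib, ← Finset.sum_add_distrib]
  refine Finset.sum_congr rfl fun j _ => ?_
  rcases lt_trichotomy i j with h | h | h
  · simp [h, h.ne', h.not_gt]
  · simp [h]
  · simp [h, h.ne, h.not_gt]

/-- The image of a pair of vertices under a permutation of the vertices. -/
def pairMap (π : Equiv.Perm (Fin n)) (e : Pairs n) : Pairs n :=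
  if h : π e.1.2 < π e.1.1 then ⟨(π e.1.1, π e.1.2), h⟩
  else ⟨(π e.1.2, π e.1.1),
    lt_of_le_of_ne (not_lt.1 h) fun he => e.2.ne' (π.injective he)⟩

theorem pairMap_cases (π : Equiv.Perm (Fin n)) (e : Pairs n) :
    (pairMap π e).1 = (π e.1.1, π e.1.2) ∨ (pairMap π e).1 = (π e.1.2, π e.1.1) := by
  unfold pairMap
  split_ifs
  · exact Or.inl rfl
  · exact Or.inr rfl

theorem pairMap_pairMap_of_leftInverse {π κ : Equiv.Perm (Fin n)} (h : ∀ i, κ (π i) = i)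
    (e : Pairs n) : pairMap κ (pairMap π e) = e := by
  have he := e.2
  have h' := (pairMap κ (pairMap π e)).2
  apply Subtype.ext
  rcases pairMap_cases π e with h₁ | h₁ <;>
    rcases pairMap_cases κ (pairMap π e) with h₂ | h₂ <;>
    rw [h₁] at h₂ <;> simp only [h] at h₂ <;> rw [h₂] at h' ⊢
  -- What remains are the two cases that would reverse the ordering of the pair.
  · exact absurd he h'.not_gt
  · exact absurd he h'.not_gt

/-- The action of a permutation of the vertices on the pairs of vertices. -/
def pairPerm (π : Equiv.Perm (Fin n)) : Equiv.Perm (Pairs n) where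
  toFun := pairMap π
  invFun := pairMap π⁻¹
  left_inv := pairMap_pairMap_of_leftInverse fun i => by simp
  right_inv := pairMap_pairMap_of_leftInverse fun i => by simp

/-- A symmetric matrix does not see the reordering made by `pairMap`. -/
theorem apply_pairPerm {M : Matrix (Fin n) (Fin n) ℝ} (hM : M.IsSymm) (π : Equiv.Perm (Fin n))
    (e : Pairs n) :
    M (pairPerm π e).1.1 (pairPerm π e).1.2 = M (π e.1.1) (π e.1.2) := by
  rcases pairMap_cases π e with h | h <;> simp only [pairPerm, Equiv.coe_fn_mk, h]
  exact hM.apply _ _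

/-- If `i` is moved and `j` is neither `i` nor `π i`, then `{i, j}` is moved. Each moved `i` has `n
- 2` such partners, and an unordered pair is counted at most twice. -/
theorem card_support_pairPerm (π : Equiv.Perm (Fin n)) :
    (π.support.card : ℝ) * (n - 2) ≤ 2 * (pairPerm π).support.card := by
  set f : Fin n → Fin n → ℝ := fun i j => if π i ≠ i ∧ j ≠ i ∧ j ≠ π i then 1 else 0 with hf
  have hrow : ∀ i, ∑ j, f i j = if π i ≠ i then (n : ℝ) - 2 else 0 := by
    intro i
    split_ifs with hi
    · have hset : (Finset.univ.filter fun j => j ≠ i ∧ j ≠ π i) = ({i, π i} : Finset (Fin n))ᶜ := by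
        ext j
        simp
      have h2 : 2 ≤ n := by
        have := Finset.card_le_univ ({i, π i} : Finset (Fin n))
        rwa [Finset.card_pair (Ne.symm hi), Fintype.card_fin] at this
      simp only [hf, hi, ne_eq, not_false_eq_true, true_and]
      rw [Finset.sum_boole]
      simp only [ne_eq] at hset
      rw [hset, Finset.card_compl, Finset.card_pair (Ne.symm hi), Fintype.card_fin]
      push_cast [h2]
      ring
    · simp [hf, not_not.1 hi]
  have htot : ∑ i, ∑ j, f i j = (π.support.card : ℝ) * (n - 2) := by
    simp_rw [hrow]
    rw [← Finset.sum_filter, Finset.sum_const, nsmul_eq_mul]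
    rfl
  have hdiag : ∑ i, f i i = 0 := Finset.sum_eq_zero fun i _ => by simp [hf]
  rw [← htot, sum_eq_sum_diag_add_sum_pairs, hdiag, zero_add]
  have hbound : ∀ e : Pairs n, f e.1.1 e.1.2 + f e.1.2 e.1.1 ≤
      if pairPerm π e ≠ e then 2 else 0 := by
    intro e
    by_cases he : pairPerm π e = e
    · have h1 : f e.1.1 e.1.2 = 0 := by
        simp only [hf]
        rw [if_neg]
        rintro ⟨h1, h2, h3⟩
        have hpe : pairMap π e = e := he
        rcases pairMap_cases π e with h | h <;> rw [hpe, Prod.ext_iff] at h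
        · exact h1 h.1.symm
        · exact h3 h.2
      have h2 : f e.1.2 e.1.1 = 0 := by
        simp only [hf]
        rw [if_neg]
        rintro ⟨h1, h2, h3⟩
        have hpe : pairMap π e = e := he
        rcases pairMap_cases π e with h | h <;> rw [hpe, Prod.ext_iff] at h
        · exact h1 h.2.symm
        · exact h3 h.1
      rw [h1, h2]
      simp [he]
    · rw [if_pos he]
      have hle : ∀ i j, f i j ≤ 1 := fun i j => by
        simp only [hf]
        split_ifs <;> norm_num
      linarith [hle e.1.1 e.1.2, hle e.1.2 e.1.1]
  refine (Finset.sum_le_sum fun e _ => hbound e).trans (le_of_eq ?_)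
  rw [← Finset.sum_filter, Finset.sum_const, nsmul_eq_mul, mul_comm]
  rfl

/-- The pairs of seeds. -/
def seedPairs (S : Finset (Fin n)) : Finset (Pairs n) :=
  Finset.univ.filter fun e => e.1.1 ∈ S ∧ e.1.2 ∈ S

theorem sum_seedPairs (S : Finset (Fin n)) (f : Fin n → Fin n → ℝ) :
    ∑ i ∈ S, ∑ j ∈ S with j < i, f i j = ∑ e ∈ seedPairs S, f e.1.1 e.1.2 := by
  rw [seedPairs, Finset.sum_filter,
    sum_pairs_eq fun i j => if i ∈ S ∧ j ∈ S then f i j else 0]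
  have hrow : ∀ i, (∑ j, if j < i then if i ∈ S ∧ j ∈ S then f i j else 0 else 0) =
      if i ∈ S then ∑ j ∈ S with j < i, f i j else 0 := by
    intro i
    split_ifs with hi
    · rw [Finset.sum_filter, ← Finset.univ_inter S, ← Finset.sum_ite_mem]
      refine Finset.sum_congr rfl fun j _ => ?_
      by_cases hj : j ∈ S <;> simp [hi, hj]
    · simp [hi]
  simp_rw [hrow]
  rw [Finset.sum_ite_mem, Finset.univ_inter]

theorem card_seedPairs (S : Finset (Fin n)) :
    (S.card : ℝ) ^ 2 = S.card + 2 * (seedPairs S).card := by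
  have := sum_eq_sum_diag_add_sum_pairs fun i j : Fin n =>
    (if i ∈ S then (1 : ℝ) else 0) * (if j ∈ S then (1 : ℝ) else 0)
  rw [← Finset.sum_mul_sum] at this
  have h1 : ∑ i : Fin n, (if i ∈ S then (1 : ℝ) else 0) = S.card := by simp
  have h2 : ∑ i : Fin n, (if i ∈ S then (1 : ℝ) else 0) * (if i ∈ S then (1 : ℝ) else 0) =
      S.card := by simp
  have h3 : ∀ e : Pairs n, (if e.1.1 ∈ S then (1 : ℝ) else 0) * (if e.1.2 ∈ S then (1 : ℝ) else 0)
      + (if e.1.2 ∈ S then (1 : ℝ) else 0) * (if e.1.1 ∈ S then (1 : ℝ) else 0) =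
      if e.1.1 ∈ S ∧ e.1.2 ∈ S then 2 else 0 := by
    intro e
    by_cases ha : e.1.1 ∈ S <;> by_cases hb : e.1.2 ∈ S <;> simp [ha, hb]
    norm_num
  simp_rw [h3] at this
  rw [h1, h2, ← Finset.sum_filter, Finset.sum_const, nsmul_eq_mul] at this
  rw [pow_two, this, mul_comm (2 : ℝ)]
  rfl

end Pairs

/-! ### Deterministic consequences of the two minimizations. -/

section Matching

variable {n : ℕ}

theorem permMatrix_conj_apply (σ : Equiv.Perm (Fin n)) (M : Matrix (Fin n) (Fin n) ℝ)
    (i j : Fin n) : (σ.permMatrix ℝ * M * (σ.permMatrix ℝ)ᵀ) i j = M (σ i) (σ j) := by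
  rw [Equiv.Perm.permMatrix, PEquiv.toMatrix_toPEquiv_mul, ← PEquiv.toMatrix_symm,
    ← Equiv.toPEquiv_symm, PEquiv.mul_toMatrix_toPEquiv]
  rfl

theorem permMatrix_conj_symm_apply (σ : Equiv.Perm (Fin n)) (M : Matrix (Fin n) (Fin n) ℝ)
    (i j : Fin n) : ((σ.permMatrix ℝ)ᵀ * M * σ.permMatrix ℝ) i j = M (σ⁻¹ i) (σ⁻¹ j) := by
  have := permMatrix_conj_apply σ⁻¹ M i j
  rwa [← transpose_permMatrix, Matrix.transpose_transpose] at this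

theorem linearMean_isSymm {A Y : Matrix (Fin n) (Fin n) ℝ} (hA : A.IsSymm) (hY : Y.IsSymm)
    (θ : Fin 3 → ℝ) : (linearMean A Y θ).IsSymm := by
  ext i j
  rw [Matrix.transpose_apply]
  by_cases h : i = j
  · rw [h]
  · rw [linearMean_apply A Y θ h, linearMean_apply A Y θ (Ne.symm h), hA.apply, hY.apply]

/-- If the matching estimator is wrong, some permutation other than the identity has a
nonpositive comparison sum. -/
theorem IsQAPSolution.exists_perm {S : Finset (Fin n)} {A Y B Qhat Qstar : Matrix (Fin n) (Fin n) ℝ}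
    {θhat : Fin 3 → ℝ} (hA : A.IsAdjMatrix) (hY : Y.IsAdjMatrix) (hB : B.IsAdjMatrix)
    (hstar : IsSeededPerm S Qstar)
    (hQ : IsQAPSolution S (linearMean A Y θhat) (Qstarᵀ * B * Qstar) Qhat)
    (hne : Qhat ≠ Qstar) :
    ∃ π : Equiv.Perm (Fin n), π ≠ 1 ∧
      θhat 1 * (∑ e ∈ (pairPerm π).support, (A e.1.1 e.1.2 -
          A (pairPerm π e).1.1 (pairPerm π e).1.2) * B e.1.1 e.1.2) +
        θhat 2 * (∑ e ∈ (pairPerm π).support, (Y e.1.1 e.1.2 -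
          Y (pairPerm π e).1.1 (pairPerm π e).1.2) * B e.1.1 e.1.2) ≤ 0 := by
  obtain ⟨⟨σ, rfl⟩, -⟩ := hQ.1
  obtain ⟨τ, hτ⟩ := hstar.1
  have hmin := hQ.2 Qstar hstar
  subst hτ
  set P := linearMean A Y θhat with hP
  set κ : Equiv.Perm (Fin n) := τ⁻¹ * σ with hκ
  have hκ1 : κ ≠ 1 := by
    intro h
    exact hne (by rw [inv_mul_eq_one.1 h])
  have e1 : ∀ i j, (σ.permMatrix ℝ * ((τ.permMatrix ℝ)ᵀ * B * τ.permMatrix ℝ) *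
      (σ.permMatrix ℝ)ᵀ) i j = B (κ i) (κ j) := fun i j => by
    rw [permMatrix_conj_apply, permMatrix_conj_symm_apply]
    rfl
  have e2 : ∀ i j, (τ.permMatrix ℝ * ((τ.permMatrix ℝ)ᵀ * B * τ.permMatrix ℝ) *
      (τ.permMatrix ℝ)ᵀ) i j = B i j := fun i j => by
    rw [permMatrix_conj_apply, permMatrix_conj_symm_apply]
    simp
  simp only [frobSq, Matrix.sub_apply, e1, e2] at hmin
  have hperm : ∀ (g : Fin n → Fin n → ℝ), ∑ i, ∑ j, g (κ i) (κ j) = ∑ i, ∑ j, g i j := by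
    intro g
    rw [← Equiv.sum_comp κ fun i => ∑ j, g i j]
    exact Finset.sum_congr rfl fun i _ => Equiv.sum_comp κ fun j => g (κ i) j
  have hexp : ∀ M : Matrix (Fin n) (Fin n) ℝ, ∑ i, ∑ j, (P i j - M i j) ^ 2 =
      ∑ i, ∑ j, P i j ^ 2 - 2 * ∑ i, ∑ j, P i j * M i j + ∑ i, ∑ j, M i j ^ 2 := by
    intro M
    simp only [Finset.mul_sum, ← Finset.sum_add_distrib, ← Finset.sum_sub_distrib]
    exact Finset.sum_congr rfl fun i _ => Finset.sum_congr rfl fun j _ => by ring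
  rw [hexp B] at hmin
  have hexp' := hexp (Matrix.of fun i j => B (κ i) (κ j))
  simp only [Matrix.of_apply] at hexp'
  rw [hexp', hperm fun i j => B i j ^ 2] at hmin
  -- Relabelling leaves the norm of `B` unchanged, so only the inner products with `P` are compared.
  -- The inverse moves the permutation from `B` to `P`.
  set π : Equiv.Perm (Fin n) := κ⁻¹ with hπ
  have hPκ : ∑ i, ∑ j, P i j * B (κ i) (κ j) = ∑ i, ∑ j, P (π i) (π j) * B i j := by
    rw [← hperm fun i j => P (π i) (π j) * B i j]
    simp [hπ]
  rw [hPκ] at hmin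
  have hle : ∑ i, ∑ j, (P i j - P (π i) (π j)) * B i j ≤ 0 := by
    simp only [sub_mul, Finset.sum_sub_distrib]
    linarith
  rw [sum_eq_sum_diag_add_sum_pairs] at hle
  have hPs : P.IsSymm := linearMean_isSymm hA.symm hY.symm θhat
  have hdiag : ∑ i, (P i i - P (π i) (π i)) * B i i = 0 :=
    Finset.sum_eq_zero fun i _ => by rw [hB.apply_diag, mul_zero]
  have hterm : ∀ e : Pairs n, (P e.1.1 e.1.2 - P (π e.1.1) (π e.1.2)) * B e.1.1 e.1.2 +
      (P e.1.2 e.1.1 - P (π e.1.2) (π e.1.1)) * B e.1.2 e.1.1 =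
      2 * (θhat 1 * ((A e.1.1 e.1.2 - A (pairPerm π e).1.1 (pairPerm π e).1.2) * B e.1.1 e.1.2) +
        θhat 2 * ((Y e.1.1 e.1.2 - Y (pairPerm π e).1.1 (pairPerm π e).1.2) *
          B e.1.1 e.1.2)) := by
    intro e
    rw [hPs.apply e.1.1 e.1.2, hPs.apply (π e.1.1) (π e.1.2), hB.symm.apply e.1.1 e.1.2,
      ← apply_pairPerm hPs, hP, linearMean_apply A Y θhat e.2.ne',
      linearMean_apply A Y θhat (pairPerm π e).2.ne']
    ring
  simp_rw [hterm] at hle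
  rw [hdiag, zero_add, ← Finset.mul_sum, Finset.sum_add_distrib, ← Finset.mul_sum,
    ← Finset.mul_sum] at hle
  have hsupp : ∀ M : Matrix (Fin n) (Fin n) ℝ,
      ∑ e : Pairs n, (M e.1.1 e.1.2 - M (pairPerm π e).1.1 (pairPerm π e).1.2) * B e.1.1 e.1.2 =
      ∑ e ∈ (pairPerm π).support, (M e.1.1 e.1.2 -
          M (pairPerm π e).1.1 (pairPerm π e).1.2) * B e.1.1 e.1.2 := by
    intro M
    refine (Finset.sum_subset (Finset.subset_univ _) fun e _ he => ?_).symm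
    rw [Equiv.Perm.notMem_support.1 he, sub_self, zero_mul]
  refine ⟨π, inv_ne_one.2 hκ1, ?_⟩
  rw [hsupp A, hsupp Y] at hle
  linarith

/-- The permutation fixes every seed, so the regression on the observed graph is a regression on `B`
itself. -/
theorem IsSeededPerm.conj_apply {S : Finset (Fin n)} {Q : Matrix (Fin n) (Fin n) ℝ}
    (hQ : IsSeededPerm S Q) (B : Matrix (Fin n) (Fin n) ℝ) {i j : Fin n} (hi : i ∈ S)
    (hj : j ∈ S) : (Qᵀ * B * Q) i j = B i j := by
  obtain ⟨⟨τ, rfl⟩, hS⟩ := hQ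
  have hfix : ∀ i ∈ S, τ⁻¹ i = i := by
    intro i hi
    have := hS i hi i hi
    rw [Matrix.one_apply_eq, Equiv.Perm.permMatrix, PEquiv.toMatrix_apply] at this
    rw [Equiv.Perm.inv_eq_iff_eq]
    by_contra hne
    rw [if_neg (by simpa [Equiv.toPEquiv_apply] using fun h => hne h.symm)] at this
    exact zero_ne_one this
  rw [permMatrix_conj_symm_apply, hfix i hi, hfix j hj]

/-- The basic inequality for the least squares estimator on the seed pairs. -/
theorem IsSeedEstimator.basic_inequality {S : Finset (Fin n)}
    {A Y B Q : Matrix (Fin n) (Fin n) ℝ} {θhat : Fin 3 → ℝ} (hQ : IsSeededPerm S Q)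
    (hθ : IsSeedEstimator S A Y (Qᵀ * B * Q) θhat) (θ : Fin 3 → ℝ) :
    ∑ e ∈ seedPairs S, ((θhat 0 - θ 0) + (θhat 1 - θ 1) * A e.1.1 e.1.2 +
        (θhat 2 - θ 2) * Y e.1.1 e.1.2) ^ 2 ≤
      2 * ∑ e ∈ seedPairs S,
        (B e.1.1 e.1.2 - (θ 0 + θ 1 * A e.1.1 e.1.2 + θ 2 * Y e.1.1 e.1.2)) *
        ((θhat 0 - θ 0) + (θhat 1 - θ 1) * A e.1.1 e.1.2 +
          (θhat 2 - θ 2) * Y e.1.1 e.1.2) := by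
  have hloss : ∀ η : Fin 3 → ℝ, seedLoss S A Y (Qᵀ * B * Q) η =
      ∑ e ∈ seedPairs S, (-(B e.1.1 e.1.2 * (η 0 + η 1 * A e.1.1 e.1.2 + η 2 * Y e.1.1 e.1.2)) +
        (η 0 + η 1 * A e.1.1 e.1.2 + η 2 * Y e.1.1 e.1.2) ^ 2 / 2) := by
    intro η
    rw [seedLoss, sum_seedPairs S fun i j => -((Qᵀ * B * Q) i j * (predictor A Y i j ⬝ᵥ η)) +
      (predictor A Y i j ⬝ᵥ η) ^ 2 / 2]
    refine Finset.sum_congr rfl fun e he => ?_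
    simp only [seedPairs, Finset.mem_filter, Finset.mem_univ, true_and] at he
    have hlin : predictor A Y e.1.1 e.1.2 ⬝ᵥ η = η 0 + η 1 * A e.1.1 e.1.2 + η 2 * Y e.1.1 e.1.2 :=
      linearMean_apply A Y η e.2.ne'
    rw [hlin, hQ.conj_apply B he.1 he.2]
  have h := hθ θ
  rw [hloss, hloss, ← sub_nonpos, ← Finset.sum_sub_distrib] at h
  rw [← sub_nonpos, Finset.mul_sum, ← Finset.sum_sub_distrib]
  calc _ = 2 * _ := ?_
    _ ≤ 0 := mul_nonpos_of_nonneg_of_nonpos zero_le_two h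
  rw [Finset.mul_sum]
  exact Finset.sum_congr rfl fun e _ => by ring

end Matching

/-! ### Moments of a single edge triple and of an independent pair. -/

section Moments

variable (p q : ℝ) (θ : Fin 3 → ℝ)

/-- The difference between the response and its conditional mean. -/
noncomputable def residual (θ : Fin 3 → ℝ) (z : Bool × Bool × Bool) : ℝ :=
  bit z.2.2 - (θ 0 + θ 1 * bit z.1 + θ 2 * bit z.2.1)

theorem moment_fst : ∑ z, tripleWeight p q θ z * (bit z.1 - p) = 0 := by
  rw [sum_triple]; simp [tripleWeight]; ring

theorem moment_snd : ∑ z, tripleWeight p q θ z * (bit z.2.1 - q) = 0 := by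
  rw [sum_triple]; simp [tripleWeight]; ring

theorem moment_fst_sq : ∑ z, tripleWeight p q θ z * (bit z.1 - p) ^ 2 = p * (1 - p) := by
  rw [sum_triple]; simp [tripleWeight]; ring

theorem moment_snd_sq : ∑ z, tripleWeight p q θ z * (bit z.2.1 - q) ^ 2 = q * (1 - q) := by
  rw [sum_triple]; simp [tripleWeight]; ring

theorem moment_fst_sq_centered :
    ∑ z, tripleWeight p q θ z * ((bit z.1 - p) ^ 2 - p * (1 - p)) = 0 := by
  rw [sum_triple]; simp [tripleWeight]; ring

theorem moment_snd_sq_centered :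
    ∑ z, tripleWeight p q θ z * ((bit z.2.1 - q) ^ 2 - q * (1 - q)) = 0 := by
  rw [sum_triple]; simp [tripleWeight]; ring

theorem moment_fst_sq_centered_sq : ∑ z, tripleWeight p q θ z *
    ((bit z.1 - p) ^ 2 - p * (1 - p)) ^ 2 = (1 - 2 * p) ^ 2 * (p * (1 - p)) := by
  rw [sum_triple]; simp [tripleWeight]; ring

theorem moment_snd_sq_centered_sq : ∑ z, tripleWeight p q θ z *
    ((bit z.2.1 - q) ^ 2 - q * (1 - q)) ^ 2 = (1 - 2 * q) ^ 2 * (q * (1 - q)) := by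
  rw [sum_triple]; simp [tripleWeight]; ring

theorem moment_cross : ∑ z, tripleWeight p q θ z * ((bit z.1 - p) * (bit z.2.1 - q)) = 0 := by
  rw [sum_triple]; simp [tripleWeight]; ring

theorem moment_cross_sq : ∑ z, tripleWeight p q θ z *
    ((bit z.1 - p) * (bit z.2.1 - q)) ^ 2 = p * (1 - p) * (q * (1 - q)) := by
  rw [sum_triple]; simp [tripleWeight]; ring

theorem moment_residual (c : Bool → Bool → ℝ) :
    ∑ z, tripleWeight p q θ z * (c z.1 z.2.1 * residual θ z) = 0 := by
  rw [sum_triple]; simp [tripleWeight, residual]; ring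

variable {p q θ}

/-- The conditional variance of the response is `P(1-P)`, so without the weight `c` the gap is
`E[P²] ≥ 0`. -/
theorem moment_residual_sq_le (hp : p ∈ Set.Ioo (0 : ℝ) 1) (hq : q ∈ Set.Ioo (0 : ℝ) 1)
    (hw : ∀ z, 0 ≤ tripleWeight p q θ z) (c : Bool → Bool → ℝ) (hc : ∀ a y, |c a y| ≤ 1) :
    ∑ z, tripleWeight p q θ z * (c z.1 z.2.1 * residual θ z) ^ 2 ≤ meanLevel θ p q := by
  have h1 : ∑ z, tripleWeight p q θ z * (c z.1 z.2.1 * residual θ z) ^ 2 ≤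
      ∑ z, tripleWeight p q θ z * residual θ z ^ 2 := by
    refine Finset.sum_le_sum fun z _ => mul_le_mul_of_nonneg_left ?_ (hw z)
    rw [mul_pow]
    exact mul_le_of_le_one_left (sq_nonneg _) ((sq_le_one_iff_abs_le_one _).2 (hc _ _))
  have h2 : meanLevel θ p q - ∑ z, tripleWeight p q θ z * residual θ z ^ 2 =
      p * q * (θ 0 + θ 1 + θ 2) ^ 2 + p * (1 - q) * (θ 0 + θ 1) ^ 2 +
      (1 - p) * q * (θ 0 + θ 2) ^ 2 + (1 - p) * (1 - q) * θ 0 ^ 2 := by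
    rw [sum_triple]; simp [tripleWeight, residual, meanLevel]; ring
  have hp' : 0 ≤ 1 - p := by linarith [hp.2]
  have hq' : 0 ≤ 1 - q := by linarith [hq.2]
  have hp0 := hp.1.le
  have hq0 := hq.1.le
  have h3 : 0 ≤ p * q * (θ 0 + θ 1 + θ 2) ^ 2 + p * (1 - q) * (θ 0 + θ 1) ^ 2 +
      (1 - p) * q * (θ 0 + θ 2) ^ 2 + (1 - p) * (1 - q) * θ 0 ^ 2 := by positivity
  linarith

/-- The covariance of two functions as a double sum. -/
theorem sum_sum_sub_mul {T : Type*} [Fintype T] {w : T → ℝ} (hw1 : ∑ z, w z = 1)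
    (f g : T → ℝ) : ∑ z, ∑ z', w z * w z' * ((f z - f z') * g z) =
      ∑ z, w z * (f z * g z) - (∑ z, w z * f z) * ∑ z, w z * g z := by
  have : ∑ z, w z * (f z * g z) = (∑ z, w z * (f z * g z)) * ∑ z, w z := by rw [hw1, mul_one]
  rw [this, Finset.sum_mul_sum, mul_comm (∑ z, w z * f z), Finset.sum_mul_sum,
    ← Finset.sum_sub_distrib]
  refine Finset.sum_congr rfl fun z _ => ?_
  rw [← Finset.sum_sub_distrib]
  exact Finset.sum_congr rfl fun z' _ => by ring

/-- The factor `g` is dropped; two independent copies of `f` differ by twice the variance in mean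
square. -/
theorem sum_sum_sub_mul_sq_le {T : Type*} [Fintype T] {w : T → ℝ} (hw : ∀ z, 0 ≤ w z)
    (hw1 : ∑ z, w z = 1) (f g : T → ℝ) (hg : ∀ z, |g z| ≤ 1) :
    ∑ z, ∑ z', w z * w z' * ((f z - f z') * g z) ^ 2 ≤
      2 * (∑ z, w z * f z ^ 2 - (∑ z, w z * f z) ^ 2) := by
  calc ∑ z, ∑ z', w z * w z' * ((f z - f z') * g z) ^ 2
      ≤ ∑ z, ∑ z', w z * w z' * (f z - f z') ^ 2 := by
        refine Finset.sum_le_sum fun z _ => Finset.sum_le_sum fun z' _ =>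
          mul_le_mul_of_nonneg_left ?_ (mul_nonneg (hw z) (hw z'))
        rw [mul_pow]
        exact mul_le_of_le_one_right (sq_nonneg _) ((sq_le_one_iff_abs_le_one _).2 (hg _))
    _ = (∑ z, w z * f z ^ 2) * (∑ z, w z) + (∑ z, w z) * (∑ z, w z * f z ^ 2) -
          2 * ((∑ z, w z * f z) * ∑ z, w z * f z) := by
        rw [Finset.sum_mul_sum, Finset.sum_mul_sum, Finset.sum_mul_sum]
        simp only [Finset.mul_sum, ← Finset.sum_add_distrib, ← Finset.sum_sub_distrib]
        exact Finset.sum_congr rfl fun z _ => Finset.sum_congr rfl fun z' _ => by ring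
    _ = _ := by rw [hw1]; ring

/-- The signal of one moved pair: as `A` and `Y` are independent and the conditional mean is linear,
only the coefficient of `A` remains. -/
theorem cov_fst_response : ∑ z, ∑ z', tripleWeight p q θ z * tripleWeight p q θ z' *
    ((bit z.1 - bit z'.1) * bit z.2.2) = p * (1 - p) * θ 1 := by
  rw [sum_sum_sub_mul (sum_tripleWeight p q θ) (fun z => bit z.1) fun z => bit z.2.2]
  simp only [sum_triple]; simp [tripleWeight]; ring

theorem cov_snd_response : ∑ z, ∑ z', tripleWeight p q θ z * tripleWeight p q θ z' *
    ((bit z.2.1 - bit z'.2.1) * bit z.2.2) = q * (1 - q) * θ 2 := by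
  rw [sum_sum_sub_mul (sum_tripleWeight p q θ) (fun z => bit z.2.1) fun z => bit z.2.2]
  simp only [sum_triple]; simp [tripleWeight]; ring

theorem abs_bit_le_one (b : Bool) : |bit b| ≤ 1 := by cases b <;> simp

theorem abs_bit_sub_bit_mul_bit_le_one (a b c : Bool) : |(bit a - bit b) * bit c| ≤ 1 := by
  cases a <;> cases b <;> cases c <;> simp

theorem var_fst_response_le (hw : ∀ z, 0 ≤ tripleWeight p q θ z) :
    ∑ z, ∑ z', tripleWeight p q θ z * tripleWeight p q θ z' *
      ((bit z.1 - bit z'.1) * bit z.2.2) ^ 2 ≤ 2 * (p * (1 - p)) := by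
  refine (sum_sum_sub_mul_sq_le hw (sum_tripleWeight p q θ) (fun z => bit z.1)
    (fun z => bit z.2.2) fun z => abs_bit_le_one _).trans (le_of_eq ?_)
  simp only [sum_triple]; simp [tripleWeight]; ring

theorem var_snd_response_le (hw : ∀ z, 0 ≤ tripleWeight p q θ z) :
    ∑ z, ∑ z', tripleWeight p q θ z * tripleWeight p q θ z' *
      ((bit z.2.1 - bit z'.2.1) * bit z.2.2) ^ 2 ≤ 2 * (q * (1 - q)) := by
  refine (sum_sum_sub_mul_sq_le hw (sum_tripleWeight p q θ) (fun z => bit z.2.1)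
    (fun z => bit z.2.2) fun z => abs_bit_le_one _).trans (le_of_eq ?_)
  simp only [sum_triple]; simp [tripleWeight]; ring

end Moments

/-! ### The Bernstein exponent and the deterministic inequalities. -/

/-- Two-sided form of `IsIIDWith.bernstein_moved`. -/
theorem IsIIDWith.bernstein_moved_abs {Ω ι T : Type*} [MeasurableSpace Ω] [Fintype T]
    [MeasurableSpace T] [DiscreteMeasurableSpace T] {μ : Measure Ω} [IsProbabilityMeasure μ]
    {Z : ι → Ω → T} {w : T → ℝ} [Fintype ι] [DecidableEq ι] (h : IsIIDWith μ Z w)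
    (hw : ∀ z, 0 ≤ w z) (hw1 : ∑ z, w z = 1) (ρ : Equiv.Perm ι) (F : T → T → ℝ)
    (hF : ∀ z z', |F z z'| ≤ 1) {μ₀ v t l : ℝ}
    (hmean : ∑ z, ∑ z', w z * w z' * F z z' = μ₀)
    (hvar : ∑ z, ∑ z', w z * w z' * F z z' ^ 2 ≤ v) (hv : 0 ≤ v) (hl0 : 0 ≤ l) (hl1 : l ≤ 1) :
    μ.real {ω | 3 * t ≤ |∑ e ∈ ρ.support, F (Z e ω) (Z (ρ e) ω) - ρ.support.card * μ₀|} ≤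
      6 * Real.exp (-(l * t) + l ^ 2 * (ρ.support.card * v)) := by
  have h1 := h.bernstein_moved hw hw1 ρ F hF (t := t) hmean hvar hv hl0 hl1
  have h2 := h.bernstein_moved hw hw1 ρ (fun z z' => -F z z') (t := t) (μ₀ := -μ₀)
    (fun z z' => by rw [abs_neg]; exact hF z z') (by simp [hmean]) (by simpa using hvar) hv hl0 hl1
  refine (measureReal_mono (fun ω hω => ?_)).trans
    ((measureReal_union_le _ _).trans ((add_le_add h1 h2).trans (le_of_eq (by ring))))
  simp only [Set.mem_union, Set.mem_ofPred_eq, Finset.sum_neg_distrib] at hω ⊢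
  rcases le_abs.1 hω with h | h
  · left; linarith
  · right; linarith

/-- The choice of the exponent in Bernstein's inequality. -/
theorem exists_bernstein_exponent {N k n L σ V : ℝ} (hσ : 0 < σ) (hV : 0 < V) (hk : 0 ≤ k)
    (hn : 0 ≤ n) (hN : k * n / 4 ≤ N) (hVn : 9600 * L ≤ n * V ^ 2) (hσn : 6 * L ≤ n * σ ^ 2) :
    ∃ l : ℝ, 0 ≤ l ∧ l ≤ 1 ∧
      -(l * (N * σ * V / 10)) + l ^ 2 * (N * (2 * σ ^ 2)) ≤ -(3 * L) * k := by
  have hN0 : 0 ≤ N := le_trans (by positivity) hN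
  by_cases hc : V ≤ 40 * σ
  -- The minimizer of the quadratic in `l`, with value `-NV²/800`; with `N ≥ kn/4` the constant 9600
  -- = 3·4·800 gives `-3Lk`.
  · refine ⟨V / (40 * σ), by positivity, (div_le_one (by positivity)).2 hc, ?_⟩
    have heq : -(V / (40 * σ) * (N * σ * V / 10)) + (V / (40 * σ)) ^ 2 * (N * (2 * σ ^ 2)) =
        -(N * V ^ 2 / 800) := by
      field_simp
      ring
    rw [heq]
    have h1 : k * n / 4 * V ^ 2 ≤ N * V ^ 2 := mul_le_mul_of_nonneg_right hN (sq_nonneg _)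
    have h2 := mul_le_mul_of_nonneg_left hVn hk
    linarith
  -- The minimizer exceeds the cap `1`. At `l = 1` the linear term is at most `-4Nσ²`, leaving
  -- `-2Nσ²`.
  · refine ⟨1, zero_le_one, le_rfl, ?_⟩
    push Not at hc
    have h0 : N * σ * (40 * σ) ≤ N * σ * V := mul_le_mul_of_nonneg_left hc.le (by positivity)
    have h1 : k * n / 4 * σ ^ 2 ≤ N * σ ^ 2 := mul_le_mul_of_nonneg_right hN (sq_nonneg _)
    have h2 := mul_le_mul_of_nonneg_left hσn hk
    linarith

/-- If the moved sums are close to their means and the estimator is close to the truth, then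
the comparison sum is positive. -/
theorem comparison_pos {N σ₁ σ₂ V t₁ t₂ s₁ s₂ T₁ T₂ : ℝ} (hN : 0 < N) (hσ₁ : 0 < σ₁)
    (hσ₂ : 0 < σ₂) (hV : 0 < V) (hV2 : V ^ 2 = t₁ ^ 2 * σ₁ ^ 2 + t₂ ^ 2 * σ₂ ^ 2)
    (hs : (s₁ - t₁) ^ 2 * σ₁ ^ 2 + (s₂ - t₂) ^ 2 * σ₂ ^ 2 ≤ V ^ 2 / 16)
    (hT₁ : |T₁ - N * (σ₁ ^ 2 * t₁)| < 3 * (N * σ₁ * V / 10))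
    (hT₂ : |T₂ - N * (σ₂ ^ 2 * t₂)| < 3 * (N * σ₂ * V / 10)) :
    0 < s₁ * T₁ + s₂ * T₂ := by
  set x₁ := t₁ * σ₁ with hx₁
  set x₂ := t₂ * σ₂ with hx₂
  set y₁ := s₁ * σ₁ with hy₁
  set y₂ := s₂ * σ₂ with hy₂
  obtain ⟨r₁, hr₁⟩ : ∃ r, r = T₁ - N * (σ₁ ^ 2 * t₁) := ⟨_, rfl⟩
  obtain ⟨r₂, hr₂⟩ : ∃ r, r = T₂ - N * (σ₂ ^ 2 * t₂) := ⟨_, rfl⟩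
  rw [← hr₁] at hT₁
  rw [← hr₂] at hT₂
  have hVx : V ^ 2 = x₁ ^ 2 + x₂ ^ 2 := by rw [hV2, hx₁, hx₂]; ring
  have hd : (y₁ - x₁) ^ 2 + (y₂ - x₂) ^ 2 ≤ V ^ 2 / 16 := by
    refine le_trans (le_of_eq ?_) hs
    rw [hx₁, hx₂, hy₁, hy₂]; ring
  have hyy : y₁ ^ 2 + y₂ ^ 2 ≤ 25 / 16 * V ^ 2 := by
    linarith [sq_nonneg (x₁ - 4 * (y₁ - x₁)), sq_nonneg (x₂ - 4 * (y₂ - x₂))]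
  have hnorm : (y₁ + y₂) ^ 2 ≤ (2 * V) ^ 2 ∧ (y₁ - y₂) ^ 2 ≤ (2 * V) ^ 2 := by
    constructor <;> linarith [sq_nonneg (y₁ - y₂), sq_nonneg (y₁ + y₂), sq_nonneg V]
  have hyabs : |y₁| + |y₂| ≤ 2 * V := by
    have e1 := abs_le_of_sq_le_sq' hnorm.1 (by positivity)
    have e2 := abs_le_of_sq_le_sq' hnorm.2 (by positivity)
    rcases abs_cases y₁ with ⟨h1, _⟩ | ⟨h1, _⟩ <;> rcases abs_cases y₂ with ⟨h2, _⟩ | ⟨h2, _⟩ <;>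
      rw [h1, h2] <;> linarith [e1.1, e1.2, e2.1, e2.2]
  have hdot : 3 / 4 * V ^ 2 ≤ y₁ * x₁ + y₂ * x₂ := by
    linarith [sq_nonneg (4 * (y₁ - x₁) + x₁), sq_nonneg (4 * (y₂ - x₂) + x₂)]
  have hsr : ∀ {s r σ : ℝ}, 0 < σ → |r| < 3 * (N * σ * V / 10) →
      -(|s * σ| * (3 * (N * V / 10))) ≤ s * r := by
    intro s r σ hσ hr
    have h1 : |s * r| ≤ |s * σ| * (3 * (N * V / 10)) := by
      rw [abs_mul, abs_mul, abs_of_pos hσ]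
      calc |s| * |r| ≤ |s| * (3 * (N * σ * V / 10)) :=
            mul_le_mul_of_nonneg_left hr.le (abs_nonneg _)
        _ = _ := by ring
    linarith [neg_abs_le (s * r)]
  have hm₁ := hsr (s := s₁) hσ₁ hT₁
  have hm₂ := hsr (s := s₂) hσ₂ hT₂
  rw [← hy₁] at hm₁
  rw [← hy₂] at hm₂
  -- The signal is at least `(3/4)NV²`, while the noise is at most `2V · (3/10)NV = (3/5)NV²`.
  have hsum : s₁ * T₁ + s₂ * T₂ = N * (y₁ * x₁ + y₂ * x₂) + s₁ * r₁ + s₂ * r₂ := by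
    rw [hr₁, hr₂, hx₁, hx₂, hy₁, hy₂]; ring
  have h3 : (|y₁| + |y₂|) * (3 * (N * V / 10)) ≤ 2 * V * (3 * (N * V / 10)) :=
    mul_le_mul_of_nonneg_right hyabs (by positivity)
  have h4 := mul_le_mul_of_nonneg_left hdot hN.le
  have h5 : 0 < N * V ^ 2 := by positivity
  rw [hsum]
  linarith

/-- The deterministic error bound for least squares with two centred predictors whose empirical
moments are close to their means. -/
theorem least_squares_error {ι : Type*} (C : Finset ι) (a y ε : ι → ℝ) {σ₁ σ₂ V u d₁ d₂ M : ℝ}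
    (hM : M = C.card) (hMpos : 0 < M) (hσ₁ : 0 < σ₁) (hσ₂ : 0 < σ₂)
    (hbasic : ∑ e ∈ C, (u + d₁ * a e + d₂ * y e) ^ 2 ≤
      2 * ∑ e ∈ C, ε e * (u + d₁ * a e + d₂ * y e))
    (h₁ : (∑ e ∈ C, a e) ^ 2 < M ^ 2 / 36 * σ₁ ^ 2)
    (h₂ : (∑ e ∈ C, y e) ^ 2 < M ^ 2 / 36 * σ₂ ^ 2)
    (h₃ : (∑ e ∈ C, (a e ^ 2 - σ₁ ^ 2)) ^ 2 < M ^ 2 / 36 * (σ₁ ^ 2 * σ₁ ^ 2))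
    (h₄ : (∑ e ∈ C, (y e ^ 2 - σ₂ ^ 2)) ^ 2 < M ^ 2 / 36 * (σ₂ ^ 2 * σ₂ ^ 2))
    (h₅ : (∑ e ∈ C, a e * y e) ^ 2 < M ^ 2 / 36 * (σ₁ ^ 2 * σ₂ ^ 2))
    (h₆ : (∑ e ∈ C, ε e) ^ 2 < M ^ 2 * V ^ 2 / 768)
    (h₇ : (∑ e ∈ C, a e * ε e) ^ 2 < M ^ 2 * V ^ 2 / 768 * σ₁ ^ 2)
    (h₈ : (∑ e ∈ C, y e * ε e) ^ 2 < M ^ 2 * V ^ 2 / 768 * σ₂ ^ 2) :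
    d₁ ^ 2 * σ₁ ^ 2 + d₂ ^ 2 * σ₂ ^ 2 ≤ V ^ 2 / 16 := by
  have hquad : ∑ e ∈ C, (u + d₁ * a e + d₂ * y e) ^ 2 =
      M * (u ^ 2 + d₁ ^ 2 * σ₁ ^ 2 + d₂ ^ 2 * σ₂ ^ 2) + 2 * u * d₁ * ∑ e ∈ C, a e +
        2 * u * d₂ * ∑ e ∈ C, y e + d₁ ^ 2 * ∑ e ∈ C, (a e ^ 2 - σ₁ ^ 2) +
        d₂ ^ 2 * ∑ e ∈ C, (y e ^ 2 - σ₂ ^ 2) + 2 * d₁ * d₂ * ∑ e ∈ C, a e * y e := by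
    have hMs : M * (u ^ 2 + d₁ ^ 2 * σ₁ ^ 2 + d₂ ^ 2 * σ₂ ^ 2) =
        ∑ e ∈ C, (u ^ 2 + d₁ ^ 2 * σ₁ ^ 2 + d₂ ^ 2 * σ₂ ^ 2) := by
      rw [Finset.sum_const, nsmul_eq_mul, hM]
    rw [hMs]
    simp only [Finset.mul_sum, ← Finset.sum_add_distrib]
    exact Finset.sum_congr rfl fun e _ => by ring
  have hlin : ∑ e ∈ C, ε e * (u + d₁ * a e + d₂ * y e) =
      u * ∑ e ∈ C, ε e + d₁ * ∑ e ∈ C, a e * ε e + d₂ * ∑ e ∈ C, y e * ε e := by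
    simp only [Finset.mul_sum, ← Finset.sum_add_distrib]
    exact Finset.sum_congr rfl fun e _ => by ring
  rw [hquad, hlin] at hbasic
  generalize ∑ e ∈ C, a e = S₁ at *
  generalize ∑ e ∈ C, y e = S₂ at *
  generalize ∑ e ∈ C, (a e ^ 2 - σ₁ ^ 2) = S₃ at *
  generalize ∑ e ∈ C, (y e ^ 2 - σ₂ ^ 2) = S₄ at *
  generalize ∑ e ∈ C, a e * y e = S₅ at *
  generalize ∑ e ∈ C, ε e = S₆ at *
  generalize ∑ e ∈ C, a e * ε e = S₇ at *
  generalize ∑ e ∈ C, y e * ε e = S₈ at *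
  have hcross : ∀ {c d S s t : ℝ}, 0 ≤ s → 0 ≤ t → S ^ 2 < M ^ 2 / 36 * (s ^ 2 * t ^ 2) →
      -(M / 6 * (c ^ 2 * s ^ 2 + d ^ 2 * t ^ 2)) ≤ 2 * c * d * S := by
    intro c d S s t hs ht hS
    have hS' : |S| ≤ M / 6 * (s * t) := by
      apply abs_le_of_sq_le_sq _ (by positivity)
      refine hS.le.trans (le_of_eq (by ring))
    have h1 : |2 * c * d * S| ≤ 2 * |c| * |d| * (M / 6 * (s * t)) := by
      rw [abs_mul, abs_mul, abs_mul, abs_two]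
      exact mul_le_mul_of_nonneg_left hS' (by positivity)
    have h2 : 2 * |c| * |d| * (M / 6 * (s * t)) ≤ M / 6 * (c ^ 2 * s ^ 2 + d ^ 2 * t ^ 2) := by
      have := mul_nonneg (show 0 ≤ M / 6 by positivity) (sq_nonneg (|c| * s - |d| * t))
      rw [← sq_abs c, ← sq_abs d]
      linarith
    linarith [neg_abs_le (2 * c * d * S)]
  -- The intercept has scale `1`. The diagonal terms `c3` and `c4` below are the case of two equal
  -- coefficients.
  have c1 := hcross (c := u) (d := d₁) (S := S₁) (s := 1) (t := σ₁) zero_le_one hσ₁.le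
    (by simpa using h₁)
  have c2 := hcross (c := u) (d := d₂) (S := S₂) (s := 1) (t := σ₂) zero_le_one hσ₂.le
    (by simpa using h₂)
  have c3 := hcross (c := d₁) (d := d₁) (S := S₃) hσ₁.le hσ₁.le h₃
  have c4 := hcross (c := d₂) (d := d₂) (S := S₄) hσ₂.le hσ₂.le h₄
  have c5 := hcross (c := d₁) (d := d₂) (S := S₅) hσ₁.le hσ₂.le h₅
  have hnoise : ∀ {c S s : ℝ}, 0 < s → S ^ 2 < M ^ 2 * V ^ 2 / 768 * s ^ 2 →
      2 * (c * S) ≤ M / 4 * (c ^ 2 * s ^ 2) + M * V ^ 2 / 192 := by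
    intro c S s hs hS
    have h1 : (S / s) ^ 2 ≤ M ^ 2 * V ^ 2 / 768 := by
      rw [div_pow, div_le_iff₀ (by positivity)]
      exact hS.le
    have h2 : 2 * (c * S) = 2 * (c * s) * (S / s) := by
      field_simp
    -- Young's inequality, weighted so that the noise absorbs only `M/4` of the quadratic form.
    have h3 : 2 * (c * s) * (S / s) ≤ M / 4 * (c * s) ^ 2 + 4 / M * (S / s) ^ 2 := by
      have := mul_nonneg (show 0 ≤ 4 / M by positivity) (sq_nonneg (M / 4 * (c * s) - S / s))
      have he : 4 / M * (M / 4 * (c * s) - S / s) ^ 2 =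
          M / 4 * (c * s) ^ 2 - 2 * (c * s) * (S / s) + 4 / M * (S / s) ^ 2 := by
        field_simp
        ring
      linarith
    have h4 : 4 / M * (S / s) ^ 2 ≤ 4 / M * (M ^ 2 * V ^ 2 / 768) :=
      mul_le_mul_of_nonneg_left h1 (by positivity)
    have h5 : 4 / M * (M ^ 2 * V ^ 2 / 768) = M * V ^ 2 / 192 := by
      field_simp
      ring
    rw [h2]
    linarith
  have n6 := hnoise (c := u) (S := S₆) (s := 1) one_pos (by simpa using h₆)
  have n7 := hnoise (c := d₁) (S := S₇) hσ₁ h₇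
  have n8 := hnoise (c := d₂) (S := S₈) hσ₂ h₈
  have hu : 0 ≤ M * u ^ 2 := by positivity
  -- Each slope loses `3 · M/6` to the cross terms and `M/4` to the noise. The remaining `M/4` is
  -- compared with `3MV²/192 = MV²/64`.
  have hfin : M * (d₁ ^ 2 * σ₁ ^ 2 + d₂ ^ 2 * σ₂ ^ 2) ≤ M * (V ^ 2 / 16) := by
    linarith
  exact le_of_mul_le_mul_left hfin hMpos

theorem exp_neg_three_mul_log {n : ℕ} (hn : 0 < n) (k : ℕ) :
    Real.exp (-(3 * Real.log n) * k) = (((n : ℝ) ^ 3)⁻¹) ^ k := by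
  have hn' : (0 : ℝ) < n := by exact_mod_cast hn
  have h3 : Real.exp (3 * Real.log n) = (n : ℝ) ^ 3 := by
    have := Real.exp_nat_mul (Real.log n) 3
    rw [Real.exp_log hn'] at this
    exact_mod_cast this
  rw [mul_comm, Real.exp_nat_mul, Real.exp_neg, h3]

/-! ### The error probability for a fixed number of vertices. -/

section FixedSize

variable {Ω : Type*} [MeasurableSpace Ω] {μ : Measure Ω} [IsProbabilityMeasure μ] {n : ℕ}
  {p q : ℝ} {θ : Fin 3 → ℝ} {Z : Pairs n → Ω → Bool × Bool × Bool}

/-- The event that a sum over the pairs moved by `π` deviates from its mean. -/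
def movedDeviation (Z : Pairs n → Ω → Bool × Bool × Bool)
    (F : Bool × Bool × Bool → Bool × Bool × Bool → ℝ) (σ V μ₀ : ℝ)
    (π : Equiv.Perm (Fin n)) : Set Ω :=
  {ω | 3 * ((pairPerm π).support.card * σ * V / 10) ≤
    |∑ e ∈ (pairPerm π).support, F (Z e ω) (Z (pairPerm π e) ω) -
      (pairPerm π).support.card * μ₀|}

theorem card_support_pairPerm_ge (hn : 4 ≤ n) (π : Equiv.Perm (Fin n)) :
    (π.support.card : ℝ) * n / 4 ≤ (pairPerm π).support.card := by
  have h := card_support_pairPerm π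
  have hn' : (4 : ℝ) ≤ n := by exact_mod_cast hn
  have hk : (0 : ℝ) ≤ π.support.card := Nat.cast_nonneg _
  nlinarith

/-- The rate `n^(-3k)` beats the at most `n^k` permutations that move `k` vertices. -/
theorem measureReal_movedDeviation_le (h : IsIIDWith μ Z (tripleWeight p q θ))
    (hw : ∀ z, 0 ≤ tripleWeight p q θ z) (hn : 4 ≤ n)
    {F : Bool × Bool × Bool → Bool × Bool × Bool → ℝ} (hF : ∀ z z', |F z z'| ≤ 1)
    {σ V μ₀ : ℝ} (hσ : 0 < σ) (hV : 0 < V)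
    (hmean : ∑ z, ∑ z', tripleWeight p q θ z * tripleWeight p q θ z' * F z z' = μ₀)
    (hvar : ∑ z, ∑ z', tripleWeight p q θ z * tripleWeight p q θ z' * F z z' ^ 2 ≤ 2 * σ ^ 2)
    (hVn : 9600 * Real.log n ≤ n * V ^ 2) (hσn : 6 * Real.log n ≤ n * σ ^ 2)
    (π : Equiv.Perm (Fin n)) :
    μ.real (movedDeviation Z F σ V μ₀ π) ≤ 6 * (((n : ℝ) ^ 3)⁻¹) ^ π.support.card := by
  obtain ⟨l, hl0, hl1, hl⟩ := exists_bernstein_exponent hσ hV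
    (Nat.cast_nonneg π.support.card) (Nat.cast_nonneg n) (card_support_pairPerm_ge hn π) hVn hσn
  refine (h.bernstein_moved_abs hw (sum_tripleWeight p q θ) (pairPerm π) F hF hmean hvar
    (by positivity) hl0 hl1).trans ?_
  rw [← exp_neg_three_mul_log (by omega)]
  exact mul_le_mul_of_nonneg_left (Real.exp_le_exp.2 hl) (by norm_num)

/-- The event that one of the empirical moments on the seed pairs is far from its mean. -/
def seedMomentDeviation (Z : Pairs n → Ω → Bool × Bool × Bool) (C : Finset (Pairs n))
    (g : Bool × Bool × Bool → ℝ) (r : ℝ) : Set Ω :=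
  {ω | r ≤ (∑ e ∈ C, g (Z e ω)) ^ 2}

/-- The error probability of the seeded matching estimator for a fixed number of vertices. -/
theorem measureReal_ne_le {S : Finset (Fin n)} {A Y B Qhat : Ω → Matrix (Fin n) (Fin n) ℝ}
    {Qstar : Matrix (Fin n) (Fin n) ℝ} (hp : p ∈ Set.Ioo (0 : ℝ) 1) (hq : q ∈ Set.Ioo (0 : ℝ) 1)
    (hθ : ∀ a ∈ ({0, 1} : Set ℝ), ∀ y ∈ ({0, 1} : Set ℝ),
      θ 0 + θ 1 * a + θ 2 * y ∈ Set.Icc (0 : ℝ) 1)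
    (hA : IsER μ A p) (hY : IsER μ Y q)
    (hAY : IndepFun (fun ω (i j : Fin n) => A ω i j) (fun ω (i j : Fin n) => Y ω i j) μ)
    (hB : IsBernoulliResponse μ A Y B θ) (hstar : IsSeededPerm S Qstar)
    (hQ : ∀ ω, IsSeededQAPEstimator S (A ω) (Y ω) (Qstarᵀ * B ω * Qstar) (Qhat ω))
    (hn : 4 ≤ n) {M v : ℝ} (hM : M = (seedPairs S).card) (hMpos : 0 < M)
    (hv : v = θ 1 ^ 2 * (p * (1 - p)) + θ 2 ^ 2 * (q * (1 - q))) (hvpos : 0 < v)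
    (hvn : 9600 * Real.log n ≤ n * v) (hpn : 6 * Real.log n ≤ n * (p * (1 - p)))
    (hqn : 6 * Real.log n ≤ n * (q * (1 - q))) :
    μ.real {ω | Qhat ω ≠ Qstar} ≤ 12 * ((1 + n * ((n : ℝ) ^ 3)⁻¹) ^ n - 1) +
      (36 / M * (3 + 1 / (p * (1 - p)) + 1 / (q * (1 - q))) +
        768 * meanLevel θ p q / (M * v) * (1 + 1 / (p * (1 - p)) + 1 / (q * (1 - q)))) := by
  have hp1 : 0 < 1 - p := by linarith [hp.2]
  have hq1 : 0 < 1 - q := by linarith [hq.2]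
  have hp0 := hp.1
  have hq0 := hq.1
  obtain ⟨σ₁, hσ₁, hσ₁2⟩ : ∃ σ : ℝ, 0 < σ ∧ σ ^ 2 = p * (1 - p) :=
    ⟨√(p * (1 - p)), by positivity, Real.sq_sqrt (by positivity)⟩
  obtain ⟨σ₂, hσ₂, hσ₂2⟩ : ∃ σ : ℝ, 0 < σ ∧ σ ^ 2 = q * (1 - q) :=
    ⟨√(q * (1 - q)), by positivity, Real.sq_sqrt (by positivity)⟩
  obtain ⟨V, hV, hV2⟩ : ∃ V : ℝ, 0 < V ∧ V ^ 2 = v :=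
    ⟨√v, by positivity, Real.sq_sqrt hvpos.le⟩
  have hw := tripleWeight_nonneg hp hq hθ
  set Z : Pairs n → Ω → Bool × Bool × Bool := fun e ω => edgeTriple (A ω) (Y ω) (B ω) e 
  have hZ : IsIIDWith μ Z (tripleWeight p q θ) := isIIDWith_edgeTriple hp hq hθ hA hY hAY hB
  obtain ⟨m, hm⟩ : ∃ m, m = meanLevel θ p q := ⟨_, rfl⟩
  rw [← hm]
  set F₁ : Bool × Bool × Bool → Bool × Bool × Bool → ℝ :=
    fun z z' => (bit z.1 - bit z'.1) * bit z.2.2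
  set F₂ : Bool × Bool × Bool → Bool × Bool × Bool → ℝ :=
    fun z z' => (bit z.2.1 - bit z'.2.1) * bit z.2.2
  set D₁ := movedDeviation Z F₁ σ₁ V (σ₁ ^ 2 * θ 1)
  set D₂ := movedDeviation Z F₂ σ₂ V (σ₂ ^ 2 * θ 2)
  have hD₁ : ∀ π, μ.real (D₁ π) ≤ 6 * (((n : ℝ) ^ 3)⁻¹) ^ π.support.card :=
    measureReal_movedDeviation_le hZ hw hn (fun z z' => abs_bit_sub_bit_mul_bit_le_one _ _ _)
      hσ₁ hV (by rw [hσ₁2]; exact cov_fst_response) (by rw [hσ₁2]; exact var_fst_response_le hw)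
      (by rw [hV2]; exact hvn) (by rw [hσ₁2]; exact hpn)
  have hD₂ : ∀ π, μ.real (D₂ π) ≤ 6 * (((n : ℝ) ^ 3)⁻¹) ^ π.support.card :=
    measureReal_movedDeviation_le hZ hw hn (fun z z' => abs_bit_sub_bit_mul_bit_le_one _ _ _)
      hσ₂ hV (by rw [hσ₂2]; exact cov_snd_response) (by rw [hσ₂2]; exact var_snd_response_le hw)
      (by rw [hV2]; exact hvn) (by rw [hσ₂2]; exact hqn)
  set C := seedPairs S
  set G := seedMomentDeviation Z C
  have hG : ∀ {g : Bool × Bool × Bool → ℝ} {u r b : ℝ},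
      ∑ z, tripleWeight p q θ z * g z = 0 → ∑ z, tripleWeight p q θ z * g z ^ 2 ≤ u →
      0 < r → M * u / r = b → μ.real (G g r) ≤ b := by
    intro g u r b hg hu hr hb
    have := hZ.chebyshev C g hg hu hr
    rwa [← hM, hb] at this
  have hbp : ∀ a, |bit a - p| ≤ 1 := fun a => by
    rw [abs_le]; cases a <;> simp <;> constructor <;> linarith
  have hbq : ∀ a, |bit a - q| ≤ 1 := fun a => by
    rw [abs_le]; cases a <;> simp <;> constructor <;> linarith
  have k₁ : μ.real (G (fun z => bit z.1 - p) (M ^ 2 / 36 * σ₁ ^ 2)) ≤ 36 / M :=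
    hG (moment_fst p q θ) (moment_fst_sq p q θ).le (by positivity)
      (by rw [← hσ₁2]; field_simp)
  have k₂ : μ.real (G (fun z => bit z.2.1 - q) (M ^ 2 / 36 * σ₂ ^ 2)) ≤ 36 / M :=
    hG (moment_snd p q θ) (moment_snd_sq p q θ).le (by positivity)
      (by rw [← hσ₂2]; field_simp)
  have k₃ : μ.real (G (fun z => (bit z.1 - p) ^ 2 - σ₁ ^ 2) (M ^ 2 / 36 * (σ₁ ^ 2 * σ₁ ^ 2))) ≤
      36 / M * (1 / (p * (1 - p))) := by
    refine hG (u := σ₁ ^ 2) (by rw [hσ₁2]; exact moment_fst_sq_centered p q θ) ?_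
      (by positivity) (by rw [← hσ₁2]; field_simp)
    rw [hσ₁2, moment_fst_sq_centered_sq]
    exact mul_le_of_le_one_left (by positivity) (by nlinarith)
  have k₄ : μ.real (G (fun z => (bit z.2.1 - q) ^ 2 - σ₂ ^ 2) (M ^ 2 / 36 * (σ₂ ^ 2 * σ₂ ^ 2))) ≤
      36 / M * (1 / (q * (1 - q))) := by
    refine hG (u := σ₂ ^ 2) (by rw [hσ₂2]; exact moment_snd_sq_centered p q θ) ?_
      (by positivity) (by rw [← hσ₂2]; field_simp)
    rw [hσ₂2, moment_snd_sq_centered_sq]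
    exact mul_le_of_le_one_left (by positivity) (by nlinarith)
  have k₅ : μ.real (G (fun z => (bit z.1 - p) * (bit z.2.1 - q))
      (M ^ 2 / 36 * (σ₁ ^ 2 * σ₂ ^ 2))) ≤ 36 / M :=
    hG (moment_cross p q θ) (moment_cross_sq p q θ).le (by positivity)
      (by rw [← hσ₁2, ← hσ₂2]; field_simp)
  have hres : ∀ c : Bool → Bool → ℝ, (∀ a y, |c a y| ≤ 1) →
      ∑ z, tripleWeight p q θ z * (c z.1 z.2.1 * residual θ z) ^ 2 ≤ m := by
    rw [hm]
    exact moment_residual_sq_le hp hq hw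
  have k₆ : μ.real (G (residual θ) (M ^ 2 * V ^ 2 / 768)) ≤ 768 * m / (M * v) := by
    have h0 := moment_residual p q θ fun _ _ => 1
    have h1 := hres (fun _ _ => 1) fun _ _ => by simp
    simp only [one_mul] at h0 h1
    exact hG h0 h1 (by positivity) (by rw [← hV2]; field_simp)
  have k₇ : μ.real (G (fun z => (bit z.1 - p) * residual θ z) (M ^ 2 * V ^ 2 / 768 * σ₁ ^ 2)) ≤
      768 * m / (M * v) * (1 / (p * (1 - p))) :=
    hG (moment_residual p q θ fun a _ => bit a - p)
      (hres (fun a _ => bit a - p) fun a _ => hbp a)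
      (by positivity) (by rw [← hV2, ← hσ₁2]; field_simp)
  have k₈ : μ.real (G (fun z => (bit z.2.1 - q) * residual θ z) (M ^ 2 * V ^ 2 / 768 * σ₂ ^ 2)) ≤
      768 * m / (M * v) * (1 / (q * (1 - q))) :=
    hG (moment_residual p q θ fun _ y => bit y - q)
      (hres (fun _ y => bit y - q) fun _ y => hbq y)
      (by positivity) (by rw [← hV2, ← hσ₂2]; field_simp)
  set D : Set Ω := ⋃ π ∈ (Finset.univ : Finset (Equiv.Perm (Fin n))).erase 1, (D₁ π ∪ D₂ π)
  have hD : μ.real D ≤ 12 * ((1 + n * ((n : ℝ) ^ 3)⁻¹) ^ n - 1) := by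
    refine (measureReal_biUnion_finset_le _ _).trans ?_
    calc ∑ π ∈ (Finset.univ : Finset (Equiv.Perm (Fin n))).erase 1, μ.real (D₁ π ∪ D₂ π)
        ≤ ∑ π ∈ (Finset.univ : Finset (Equiv.Perm (Fin n))).erase 1,
            12 * (((n : ℝ) ^ 3)⁻¹) ^ π.support.card :=
          Finset.sum_le_sum fun π _ => by
            linarith [measureReal_union_le (μ := μ) (D₁ π) (D₂ π), hD₁ π, hD₂ π]
      _ ≤ _ := by
          rw [← Finset.mul_sum]
          exact mul_le_mul_of_nonneg_left (sum_pow_card_support_le n (by positivity))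
            (by norm_num)
  have hsub : {ω | Qhat ω ≠ Qstar} ⊆ D ∪ (G (fun z => bit z.1 - p) (M ^ 2 / 36 * σ₁ ^ 2) ∪
      (G (fun z => bit z.2.1 - q) (M ^ 2 / 36 * σ₂ ^ 2) ∪
      (G (fun z => (bit z.1 - p) ^ 2 - σ₁ ^ 2) (M ^ 2 / 36 * (σ₁ ^ 2 * σ₁ ^ 2)) ∪
      (G (fun z => (bit z.2.1 - q) ^ 2 - σ₂ ^ 2) (M ^ 2 / 36 * (σ₂ ^ 2 * σ₂ ^ 2)) ∪
      (G (fun z => (bit z.1 - p) * (bit z.2.1 - q)) (M ^ 2 / 36 * (σ₁ ^ 2 * σ₂ ^ 2)) ∪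
      (G (residual θ) (M ^ 2 * V ^ 2 / 768) ∪
      (G (fun z => (bit z.1 - p) * residual θ z) (M ^ 2 * V ^ 2 / 768 * σ₁ ^ 2) ∪
      G (fun z => (bit z.2.1 - q) * residual θ z) (M ^ 2 * V ^ 2 / 768 * σ₂ ^ 2)))))))) := by
    intro ω hω
    by_contra hcon
    simp only [Set.mem_union, not_or] at hcon
    obtain ⟨c₀, c₁, c₂, c₃, c₄, c₅, c₆, c₇, c₈⟩ := hcon
    simp only [G, seedMomentDeviation, Set.mem_ofPred_eq, not_le] at c₁ c₂ c₃ c₄ c₅ c₆ c₇ c₈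
    obtain ⟨θhat, hest, hqap⟩ := hQ ω
    have bA : ∀ e : Pairs n, A ω e.1.1 e.1.2 = bit (Z e ω).1 := fun e =>
      (hA.isAdj ω).apply_eq_bit _ _
    have bY : ∀ e : Pairs n, Y ω e.1.1 e.1.2 = bit (Z e ω).2.1 := fun e =>
      (hY.isAdj ω).apply_eq_bit _ _
    have bB : ∀ e : Pairs n, B ω e.1.1 e.1.2 = bit (Z e ω).2.2 := fun e =>
      (hB.isAdj ω).apply_eq_bit _ _
    obtain ⟨π, hπ, hle⟩ := hqap.exists_perm (hA.isAdj ω) (hY.isAdj ω) (hB.isAdj ω) hstar hω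
    simp_rw [bA, bY, bB] at hle
    have hbasic := hest.basic_inequality hstar θ
    simp_rw [bA, bY, bB] at hbasic
    -- Centring the predictors moves their means into the intercept error `u` and leaves the slope
    -- errors unchanged.
    have herr := least_squares_error C (fun e => bit (Z e ω).1 - p)
      (fun e => bit (Z e ω).2.1 - q) (fun e => residual θ (Z e ω))
      (u := (θhat 0 - θ 0) + (θhat 1 - θ 1) * p + (θhat 2 - θ 2) * q)
      (d₁ := θhat 1 - θ 1) (d₂ := θhat 2 - θ 2) hM hMpos hσ₁ hσ₂ (by
        refine le_trans (le_of_eq ?_) (hbasic.trans (le_of_eq ?_))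
        · exact Finset.sum_congr rfl fun e _ => by ring
        · congr 1
          exact Finset.sum_congr rfl fun e _ => by rw [residual]; ring)
      c₁ c₂ c₃ c₄ c₅ c₆ c₇ c₈
    simp only [D, Set.mem_iUnion, not_exists] at c₀
    have hc := c₀ π (Finset.mem_erase.2 ⟨hπ, Finset.mem_univ _⟩)
    simp only [D₁, D₂, movedDeviation, Set.mem_union, Set.mem_ofPred_eq, not_or, not_le] at hc
    have hk : (1 : ℝ) ≤ π.support.card := by
      have : π.support.card ≠ 0 := fun h => hπ (Equiv.Perm.card_support_eq_zero.1 h)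
      exact_mod_cast Nat.one_le_iff_ne_zero.2 this
    have hN : (0 : ℝ) < (pairPerm π).support.card := by
      have hn' : (4 : ℝ) ≤ n := by exact_mod_cast hn
      refine lt_of_lt_of_le ?_ (card_support_pairPerm_ge hn π)
      positivity
    have := comparison_pos hN hσ₁ hσ₂ hV (by rw [hV2, hv, hσ₁2, hσ₂2]) herr hc.1 hc.2
    exact absurd hle (not_le.2 this)
  refine (measureReal_mono hsub).trans ?_
  have hun : ∀ {s t : Set Ω} {a b : ℝ}, μ.real s ≤ a → μ.real t ≤ b → μ.real (s ∪ t) ≤ a + b :=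
    fun hs ht => (measureReal_union_le _ _).trans (add_le_add hs ht)
  refine (hun hD (hun k₁ (hun k₂ (hun k₃ (hun k₄ (hun k₅ (hun k₆ (hun k₇ k₈)))))))).trans
    (le_of_eq ?_)
  ring

end FixedSize

/-! ### Asymptotics and the main theorem. -/

/-- On `(0,1)` one has `x ≤ √x`, hence `p + q ≤ 1`. One of `p`, `1 - p` is at least `1/2`, and the
other is at least `min p q`. -/
theorem half_min_le_variance {p q : ℝ} (hp : p ∈ Set.Ioo (0 : ℝ) 1) (hq : q ∈ Set.Ioo (0 : ℝ) 1)
    (h : √p + √q ≤ 1) : min p q / 2 ≤ p * (1 - p) := by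
  have hle : ∀ {x : ℝ}, x ∈ Set.Ioo (0 : ℝ) 1 → x ≤ √x := fun {x} hx =>
    Real.le_sqrt_of_sq_le (by nlinarith [hx.1, hx.2])
  have h1 : q ≤ 1 - p := by linarith [hle hp, hle hq]
  have hp0 := hp.1
  have hp1 := hp.2
  have hq0 := hq.1
  rcases le_total p (1 / 2) with hc | hc
  · nlinarith [min_le_left p q]
  · nlinarith [min_le_right p q]

/-- The cost of the union bound at `x = n^(-3)`, which tends to zero. -/
theorem one_add_pow_sub_one_le {n : ℕ} (hn : 0 < n) :
    (1 + n * ((n : ℝ) ^ 3)⁻¹) ^ n - 1 ≤ Real.exp (1 / n) - 1 := by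
  have hn' : (0 : ℝ) < n := by exact_mod_cast hn
  have h1 : (1 : ℝ) + n * ((n : ℝ) ^ 3)⁻¹ ≤ Real.exp (n * ((n : ℝ) ^ 3)⁻¹) := by
    linarith [Real.add_one_le_exp (n * ((n : ℝ) ^ 3)⁻¹)]
  have h2 := pow_le_pow_left₀ (by positivity) h1 n
  rw [← Real.exp_nat_mul] at h2
  have h3 : (n : ℝ) * (n * ((n : ℝ) ^ 3)⁻¹) = 1 / n := by
    field_simp
  rw [h3] at h2
  linarith

/-- The estimation error of the regression step under the signal strength condition. -/
theorem seed_error_le {s M τ R m v a b : ℝ} (hs : 2 ≤ s) (hM : s ^ 2 = s + 2 * M) (hτ : 0 < τ)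
    (hτ1 : τ ≤ 1) (hsτ : 1 ≤ s ^ 2 * τ) (hm : 0 ≤ m) (hR : 0 < R) (ha : τ / 2 ≤ a)
    (hb : τ / 2 ≤ b) (hv : τ / 2 * R ≤ v) (hlog : 0 < Real.log s)
    (hsig : 20000 * (√(Real.log s) * m / (τ ^ (3 / 2 : ℝ) * s)) ≤ R) :
    36 / M * (3 + 1 / a + 1 / b) + 768 * m / (M * v) * (1 + 1 / a + 1 / b) ≤
      1008 * (1 / (s ^ 2 * τ)) + 2 * (1 / √(Real.log s)) := by
  have hs0 : 0 < s := by linarith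
  have hM4 : s ^ 2 / 4 ≤ M := by nlinarith
  have hMpos : 0 < M := lt_of_lt_of_le (by positivity) hM4
  have hinv : ∀ {x : ℝ}, τ / 2 ≤ x → 1 / x ≤ 2 / τ := fun {x} hx => by
    have := one_div_le_one_div_of_le (by positivity) hx
    rwa [one_div_div] at this
  have ha0 : 0 < a := by linarith
  have hb0 : 0 < b := by linarith
  have h1τ : 1 ≤ 1 / τ := by rwa [le_div_iff₀ hτ, one_mul]
  have e1 : 3 + 1 / a + 1 / b ≤ 7 / τ := by
    have : (7 : ℝ) / τ = 3 * (1 / τ) + 2 / τ + 2 / τ := by ring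
    rw [this]
    linarith [hinv ha, hinv hb]
  have e2 : 1 + 1 / a + 1 / b ≤ 5 / τ := by
    have : (5 : ℝ) / τ = 1 / τ + 2 / τ + 2 / τ := by ring
    rw [this]
    linarith [hinv ha, hinv hb]
  have t1 : 36 / M * (3 + 1 / a + 1 / b) ≤ 1008 * (1 / (s ^ 2 * τ)) := by
    calc 36 / M * (3 + 1 / a + 1 / b) ≤ 36 / (s ^ 2 / 4) * (7 / τ) := by gcongr
      _ = 1008 * (1 / (s ^ 2 * τ)) := by field_simp; norm_num
  have hrpow : τ ^ (3 / 2 : ℝ) = τ * √τ := by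
    rw [Real.sqrt_eq_rpow, show (3 / 2 : ℝ) = 1 + 1 / 2 by norm_num, Real.rpow_add hτ,
      Real.rpow_one]
  have hl : 0 < √(Real.log s) := Real.sqrt_pos.2 hlog
  have hr : 0 < √τ := Real.sqrt_pos.2 hτ
  have hrr : √τ * √τ = τ := Real.mul_self_sqrt hτ.le
  have hsr : 1 ≤ s * √τ := by
    have : 1 ≤ (s * √τ) ^ 2 := by rwa [mul_pow, Real.sq_sqrt hτ.le]
    exact (one_le_sq_iff₀ (by positivity)).1 this
  have hm' : 20000 * (√(Real.log s) * m) ≤ R * (τ * √τ * s) := by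
    rw [hrpow, ← mul_div_assoc, div_le_iff₀ (by positivity)] at hsig
    exact hsig
  have t2 : 768 * m / (M * v) * (1 + 1 / a + 1 / b) ≤ 2 * (1 / √(Real.log s)) := by
    calc 768 * m / (M * v) * (1 + 1 / a + 1 / b)
        ≤ 768 * m / (s ^ 2 / 4 * (τ / 2 * R)) * (5 / τ) := by gcongr
      _ = 30720 * m / (s ^ 2 * τ ^ 2 * R) := by field_simp; ring
      _ ≤ 2 * (1 / √(Real.log s)) := by
        rw [mul_one_div, div_le_div_iff₀ (by positivity) hl]
        -- The variance bound needs only `s²τ²` where the signal condition supplies `sτ^(3/2)`; the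
        -- spare factor `s√τ` is at least `1`.
        have h3 : R * (τ * √τ * s) ≤ R * (τ * √τ * s) * (s * √τ) :=
          le_mul_of_one_le_right (by positivity) hsr
        have h4 : R * (τ * √τ * s) * (s * √τ) = s ^ 2 * τ ^ 2 * R := by
          calc R * (τ * √τ * s) * (s * √τ) = R * τ * s ^ 2 * (√τ * √τ) := by ring
            _ = _ := by rw [hrr]; ring
        rw [h4] at h3
        have h5 : 0 ≤ √(Real.log s) * m := by positivity
        linarith
  linarith

end CovMatching

theorem theorem3 :
    ∃ α₁ > (0 : ℝ), ∃ α₂ > (0 : ℝ), ∃ α₃ > (0 : ℝ),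
    ∀ (Ω : ℕ → Type*) [∀ n, MeasurableSpace (Ω n)]
      (μ : ∀ n, Measure (Ω n)) [∀ n, IsProbabilityMeasure (μ n)]
      (p q : ℕ → ℝ) (θ : ℕ → Fin 3 → ℝ) (S : ∀ n, Finset (Fin n))
      (A Y B Qhat : ∀ n, Ω n → Matrix (Fin n) (Fin n) ℝ)
      (Qstar : ∀ n, Matrix (Fin n) (Fin n) ℝ),
    -- the model
    (∀ n, p n ∈ Set.Ioo (0 : ℝ) 1) →
    (∀ n, q n ∈ Set.Ioo (0 : ℝ) 1) →
    (∀ n, ∀ a ∈ ({0, 1} : Set ℝ), ∀ y ∈ ({0, 1} : Set ℝ),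
      θ n 0 + θ n 1 * a + θ n 2 * y ∈ Set.Icc (0 : ℝ) 1) →
    (∀ n, CovMatching.IsER (μ n) (A n) (p n)) →
    (∀ n, CovMatching.IsER (μ n) (Y n) (q n)) →
    (∀ n, IndepFun (fun ω (i j : Fin n) => A n ω i j) (fun ω (i j : Fin n) => Y n ω i j) (μ n)) →
    (∀ n, CovMatching.IsBernoulliResponse (μ n) (A n) (Y n) (B n) (θ n)) →
    (∀ n, CovMatching.IsSeededPerm (S n) (Qstar n)) →
    -- the estimator, computed from `A`, `Y` and the observed graph `Q*ᵀ B Q*`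
    (∀ n ω, CovMatching.IsSeededQAPEstimator (S n) (A n ω) (Y n ω)
      ((Qstar n)ᵀ * B n ω * Qstar n) (Qhat n ω)) →
    -- the number of seeds grows
    Tendsto (fun n => (S n).card) atTop atTop →
    -- conditions for the curvature of the loss
    (∃ ν > (0 : ℝ), ∀ᶠ n in atTop, √(p n) + √(q n) ≤ 1 - ν) →
    ((fun n => max (p n) (q n)) =o[atTop]
      fun n => ((S n).card : ℝ) ^ 2 * min (p n ^ 2) (q n ^ 2)) →
    ((fun n => CovMatching.meanLevel (θ n) (p n) (q n)) =O[atTop]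
      fun n => min (p n) (q n)) →
    -- conditions for the signal strength
    (∀ᶠ n : ℕ in atTop,
      CovMatching.meanLevel (θ n) (p n) (q n) ≥ α₁ * (Real.log n / n)) →
    (∀ᶠ n : ℕ in atTop,
      min (p n) (q n) ^ 2 / (p n + q n) ≥ α₂ * (Real.log n / n)) →
    (∀ᶠ n : ℕ in atTop,
      θ n 1 ^ 2 + θ n 2 ^ 2 ≥ α₃ * max
        (Real.log n / (min (p n) (q n) * n))
        (√(Real.log (S n).card) * CovMatching.meanLevel (θ n) (p n) (q n) /
          (min (p n) (q n) ^ (3 / 2 : ℝ) * (S n).card))) →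
    Tendsto (fun n => (μ n).real {ω | Qhat n ω = Qstar n}) atTop (𝓝 1) := by
  -- Of `α₁` only positivity matters: it makes the mean level nonnegative. `α₂ = 10` gives `n p(1-p)
  -- ≥ nτ/2 ≥ 10 log n`, above the required `6 log n`. `α₃ = 20000` gives `nv ≥ 10000 log n`, above
  -- `9600 log n`, and `30720/20000 ≤ 2` in `seed_error_le`.
  refine ⟨1, one_pos, 10, by norm_num, 20000, by norm_num, ?_⟩
  intro Ω _ μ _ p q θ S A Y B Qhat Qstar hp hq hθ hA hY hAY hB hstar hQ hS hν ho _ hm hτ hR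
  obtain ⟨ν, hνpos, hν⟩ := hν
  have hτpos : ∀ n, 0 < min (p n) (q n) := fun n => lt_min (hp n).1 (hq n).1
  have hScast : Tendsto (fun n => ((S n).card : ℝ)) atTop atTop :=
    tendsto_natCast_atTop_atTop.comp hS
  -- With `τ = min p q ≤ max p q`, this is dominated by the ratio in the little-o condition.
  have hSτ : Tendsto (fun n => 1 / (((S n).card : ℝ) ^ 2 * min (p n) (q n))) atTop (𝓝 0) := by
    refine tendsto_of_tendsto_of_tendsto_of_le_of_le' tendsto_const_nhds ho.tendsto_div_nhds_zero
      (Eventually.of_forall fun n => ?_) ?_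
    · have := hτpos n
      positivity
    · filter_upwards [hScast.eventually_ge_atTop 1] with n hn
      have hτn := hτpos n
      have hmin : min (p n ^ 2) (q n ^ 2) = min (p n) (q n) ^ 2 := by
        rcases le_total (p n) (q n) with h | h
        · rw [min_eq_left h, min_eq_left (pow_le_pow_left₀ (hp n).1.le h 2)]
        · rw [min_eq_right h, min_eq_right (pow_le_pow_left₀ (hq n).1.le h 2)]
      rw [hmin, div_le_div_iff₀ (by positivity) (by positivity)]
      have hmm : min (p n) (q n) ≤ max (p n) (q n) := min_le_max
      calc 1 * (((S n).card : ℝ) ^ 2 * min (p n) (q n) ^ 2)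
          = min (p n) (q n) * (((S n).card : ℝ) ^ 2 * min (p n) (q n)) := by ring
        _ ≤ _ := mul_le_mul_of_nonneg_right hmm (by positivity)
  have hlogS : Tendsto (fun n => 1 / √(Real.log (S n).card)) atTop (𝓝 0) := by
    simp_rw [one_div]
    exact tendsto_inv_atTop_zero.comp
      (Real.tendsto_sqrt_atTop.comp (Real.tendsto_log_atTop.comp hScast))
  have hexp : Tendsto (fun n : ℕ => Real.exp (1 / n) - 1) atTop (𝓝 0) := by
    have h := (Real.continuous_exp.tendsto 0).comp (tendsto_one_div_atTop_nhds_zero_nat (𝕜 := ℝ))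
    simpa using h.sub_const 1
  have herr : Tendsto (fun n : ℕ => 1 - (12 * (Real.exp (1 / n) - 1) +
      (1008 * (1 / (((S n).card : ℝ) ^ 2 * min (p n) (q n))) +
        2 * (1 / √(Real.log (S n).card))))) atTop (𝓝 1) := by
    have h := ((hexp.const_mul 12).add ((hSτ.const_mul 1008).add (hlogS.const_mul 2))).const_sub 1
    simpa using h
  refine tendsto_of_tendsto_of_tendsto_of_le_of_le' herr tendsto_const_nhds ?_
    (Eventually.of_forall fun n => measureReal_le_one)
  filter_upwards [hν, hm, hτ, hR, hScast.eventually_ge_atTop 2, eventually_ge_atTop 4,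
    hSτ.eventually_le_const one_pos] with n hνn hmn hτn hRn hSn hn hSτn
  have hτ0 := hτpos n
  have hpq : √(p n) + √(q n) ≤ 1 := by linarith
  have hvp := CovMatching.half_min_le_variance (hp n) (hq n) hpq
  have hvq := CovMatching.half_min_le_variance (hq n) (hp n) (by linarith)
  rw [min_comm] at hvq
  have hτp : min (p n) (q n) ≤ p n := min_le_left _ _
  have hτq : min (p n) (q n) ≤ q n := min_le_right _ _
  have hτ1 : min (p n) (q n) ≤ 1 := hτp.trans (hp n).2.le
  generalize min (p n) (q n) = τ at *
  have hn4 : (4 : ℝ) ≤ n := by exact_mod_cast hn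
  have hn0 : (0 : ℝ) < n := by linarith
  have hL : 0 < Real.log n := Real.log_pos (by linarith)
  have hτL : 20 * Real.log n ≤ n * τ := by
    -- Both `p` and `q` are at least `τ`, so `p + q ≥ 2τ`.
    have h1 : τ ^ 2 / (p n + q n) ≤ τ / 2 := by
      rw [div_le_div_iff₀ (by linarith) two_pos]
      nlinarith
    have h2 : 10 * (Real.log n / n) ≤ τ / 2 := hτn.le.trans h1
    rw [← mul_div_assoc, div_le_iff₀ hn0] at h2
    linarith
  have hR1 : 20000 * Real.log n ≤ n * (τ * (θ n 1 ^ 2 + θ n 2 ^ 2)) := by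
    have h1 := (mul_le_mul_of_nonneg_left (le_max_left (Real.log n / (τ * n)) _)
      (by norm_num : (0 : ℝ) ≤ 20000)).trans hRn
    rw [← mul_div_assoc, div_le_iff₀ (by positivity)] at h1
    linarith
  have hR2 := (mul_le_mul_of_nonneg_left (le_max_right (Real.log n / (τ * n)) _)
      (by norm_num : (0 : ℝ) ≤ 20000)).trans hRn
  have hm0 : 0 ≤ CovMatching.meanLevel (θ n) (p n) (q n) :=
    le_trans (by positivity) hmn
  set v := θ n 1 ^ 2 * (p n * (1 - p n)) + θ n 2 ^ 2 * (q n * (1 - q n)) with hv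
  have hvR : τ / 2 * (θ n 1 ^ 2 + θ n 2 ^ 2) ≤ v := by
    have h1 := mul_le_mul_of_nonneg_left hvp (sq_nonneg (θ n 1))
    have h2 := mul_le_mul_of_nonneg_left hvq (sq_nonneg (θ n 2))
    linarith
  have hRpos : 0 < θ n 1 ^ 2 + θ n 2 ^ 2 := by
    by_contra hcon
    have h0 : θ n 1 ^ 2 + θ n 2 ^ 2 = 0 := le_antisymm (not_lt.1 hcon) (by positivity)
    rw [h0] at hR1
    linarith
  have hvpos : 0 < v := lt_of_lt_of_le (by positivity) hvR
  have hnv := mul_le_mul_of_nonneg_left hvR hn0.le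
  have hnp := mul_le_mul_of_nonneg_left hvp hn0.le
  have hnq := mul_le_mul_of_nonneg_left hvq hn0.le
  have hM := CovMatching.card_seedPairs (S n)
  have hMpos : (0 : ℝ) < (CovMatching.seedPairs (S n)).card := by nlinarith
  have hbound := CovMatching.measureReal_ne_le (hp n) (hq n) (hθ n) (hA n) (hY n) (hAY n) (hB n)
    (hstar n) (hQ n) hn rfl hMpos hv hvpos (by linarith) (by linarith) (by linarith)
  have hsτ : 1 ≤ ((S n).card : ℝ) ^ 2 * τ := by
    have hpos : (0 : ℝ) < ((S n).card : ℝ) ^ 2 * τ := by positivity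
    rwa [div_le_iff₀ hpos, one_mul] at hSτn
  have hseed := CovMatching.seed_error_le hSn hM hτ0 hτ1 hsτ hm0 hRpos hvp hvq hvR
    (Real.log_pos (by linarith)) hR2
  have hexpn := CovMatching.one_add_pow_sub_one_le (n := n) (by omega)
  -- Ties are broken arbitrarily, so `Qhat` need not be measurable; subadditivity replaces the
  -- complement rule.
  have hcover : (1 : ℝ) ≤ (μ n).real {ω | Qhat n ω = Qstar n} +
      (μ n).real {ω | Qhat n ω ≠ Qstar n} := by
    rw [← probReal_univ (μ := μ n)]
    refine (measureReal_mono fun ω _ => ?_).trans (measureReal_union_le _ _)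
    exact em (Qhat n ω = Qstar n)
  linarith
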